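/- A lattice in $\mathbb{R}^n$ (with the standard inner product $(\cdot,\cdot)$) is the $\mathbb{Z}$-span of an $\mathbb{R}$-basis of $\mathbb{R}^n$. For a lattice $\Lambda\subset\mathbb{R}^n$ let $\Lambda^*=\{v\in\mathbb{R}^n : (v,\lambda)\in\mathbb{Z}\text{ for all }\lambda\in\Lambda\}$ be its dual lattice, let $\min(\Lambda)=\min\{(\lambda,\lambda) : 0\neq\lambda\in\Lambda\}$, let $\mathrm{Min}(\Lambda)=\{\lambda\in\Lambda : (\lambda,\lambda)=\min(\Lambda)\}$, and let $r(\Lambda)=\min(\Lambda)\min(\Lambda^*)$. The lattice $\Lambda$ is called strongly perfect if $\mathrm{Min}(\Lambda)$ is a spherical $4$-design, i.e. if for every real polynomial $p$ in $n$ variables of degree at most $4$ the average of $p$ over the finite set $\mathrm{Min}(\Lambda)$ equals the average of $p$ over the sphere of radius $\sqrt{\min(\Lambda)}$ centred at $0$ (with respect to surface measure). It is called dual strongly perfect if both $\Lambda$ and $\Lambda^*$ are strongly perfect. **Lemma.** There is no dual strongly perfect lattice $\Lambda\subset\mathbb{R}^{16}$ with $r(\Lambda)=7$. -/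

import Mathlib

noncomputable section

namespace StronglyPerfectLattice

/-- Euclidean `n`-space `(ℝⁿ, (,))`. -/
abbrev Euc (n : ℕ) : Type := EuclideanSpace ℝ (Fin n)

/-- The dual lattice `L* = {v ∈ ℝⁿ | (v, x) ∈ ℤ for all x ∈ L}`. -/
def dual {n : ℕ} (L : Submodule ℤ (Euc n)) : Submodule ℤ (Euc n) :=
  LinearMap.BilinForm.dualSubmodule (innerₗ (Euc n)) L

theorem mem_dual_iff {n : ℕ} (L : Submodule ℤ (Euc n)) (v : Euc n) :
    v ∈ dual L ↔ ∀ x ∈ L, ∃ k : ℤ, inner ℝ v x = (k : ℝ) := by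
  simp only [dual, LinearMap.BilinForm.mem_dualSubmodule, Submodule.mem_one, innerₗ_apply_apply,
    eq_intCast]
  exact forall₂_congr fun x _ => exists_congr fun k => eq_comm

/-- The minimum `min(L) = min {(x, x) | 0 ≠ x ∈ L}` (attained if `L` is a lattice, `n > 0`). -/
def minimum {n : ℕ} (L : Submodule ℤ (Euc n)) : ℝ :=
  sInf {a : ℝ | ∃ x ∈ L, x ≠ 0 ∧ inner ℝ x x = a}

/-- The set `Min(L) = {x ∈ L | (x, x) = min(L)}` of minimal vectors. -/
def minVectors {n : ℕ} (L : Submodule ℤ (Euc n)) : Set (Euc n) :=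
  {x | x ∈ L ∧ inner ℝ x x = minimum L}

/-- The Bergé-Martinet invariant `r(L) = min(L) min(L*)`. -/
def bergeMartinet {n : ℕ} (L : Submodule ℤ (Euc n)) : ℝ :=
  minimum L * minimum (dual L)

/-- A finite non-empty subset `X` of the sphere of radius `R > 0` around the origin of `ℝⁿ` is a
spherical `t`-design if for every real polynomial `p` in `n` variables of total degree at most `t`
the average of `p` over `X` equals its average over the sphere of radius `R` (with respect to the
surface measure, transported from the unit sphere). -/
structure IsSphericalDesign {n : ℕ} (t : ℕ) (R : ℝ) (X : Set (Euc n)) : Prop where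
  radius_pos : 0 < R
  finite : X.Finite
  nonempty : X.Nonempty
  subset_sphere : X ⊆ Metric.sphere 0 R
  average_eq : ∀ p : MvPolynomial (Fin n) ℝ, p.totalDegree ≤ t →
    (∑ᶠ x ∈ X, MvPolynomial.eval (fun i => x i) p) / (X.ncard : ℝ) =
      ⨍ u : Metric.sphere (0 : Euc n) 1, MvPolynomial.eval (fun i => R * (u : Euc n) i) p
        ∂(MeasureTheory.volume : MeasureTheory.Measure (Euc n)).toSphere

/-- A lattice is strongly perfect if its minimal vectors form a spherical `4`-design. -/
def IsStronglyPerfect {n : ℕ} (L : Submodule ℤ (Euc n)) : Prop :=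
  IsSphericalDesign 4 (Real.sqrt (minimum L)) (minVectors L)

/-- A lattice is dual strongly perfect if both it and its dual are strongly perfect. -/
def IsDualStronglyPerfect {n : ℕ} (L : Submodule ℤ (Euc n)) : Prop :=
  IsStronglyPerfect L ∧ IsStronglyPerfect (dual L)

end StronglyPerfectLattice

end

/-!
The norm of a vector `v` means `(v, v)`. After rescaling, `min(L) = 1` and `min(L*) = 7`. The design
property of `X = Min(L)` and `Y = Min(L*)` says that the sums of `(x, v) ^ 2` and `(x, v) ^ 4` over
`x ∈ X`, and likewise over `Y`, are the expected multiples of `(v, v)` and `(v, v) ^ 2`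
(`DesignPair`). The inner products `(x, y)` are integers of absolute value at most `2`, so these
identities determine the ratio of `|X|` and the number of `x` with `(x, y) = 2`; since distinct `x`
have inner product at most `1 / 2`, the Cauchy–Schwarz inequality leaves only `|X| = 2304` and
seven vectors `x`, and it is an equality: the seven have pairwise inner product `1 / 2` and sum
`2 y`. By symmetry the same holds with `X` and `Y` exchanged.

Fix `α ∈ Y`, with its seven vectors `x i`. For `i ≠ j` there is a vector `β i j ∈ Y` with inner
products `2` with `x i`, `0` with `x j` and `1` with the others (`Star`). The components `b i j` of
`β i j` orthogonal to all `x m` form a skew-symmetric system of vectors of norm `5 / 4`, with inner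
product `-1 / 4` when they share the first index and an odd multiple of `1 / 4` when the indices
are disjoint (`SkewSystem`). The triangle vectors `α / 2 + b i j + b j k + b k i` lie in `Y` again.
Since distinct vectors of `Y` have inner product at most `7 / 2`, the numbers `ω i j k l`, four
times the inner product of `b i j` and `b k l`, are totally skew-symmetric (`om_swap_mid`), and the
numbers `θ i j k l m`, four times the inner product of the triangle sums of `b` for `i j k` and
`i l m`, are odd integers with `|θ| ≤ 7` (`abs_theta_le`).

In fact `|θ| = 7` throughout. The vectors `b i j` live in the space of dimension `9` orthogonal to
the `x m`, so an inequality between the traces of `∑ (b i j, ·) b i j` and of its square bounds the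
sum of the `ω ^ 2` from below (`le_sum_om_sq`). The form `θ` is the coboundary of `ω`, and it is
dual to a skew-symmetric matrix `h` of order `7` with odd entries and zero row sums. The entries of
`h` are determined modulo `7` by its first row, and the sum of their squares is `14` times that of
the `ω`, summed over the `35` sets of four indices. Since an odd integer of absolute value at most
`7` is `± 7` or determined by its class modulo `7`, what remains is a question about the sizes of
the classes of the entries of the first row, and the answer is that they all agree
(`abs_eq_seven`).

When all `|θ| = 7`, a relabelling of the indices gives the signs a fixed pattern
(`HasSigns.normalize`), and then `α` and seven triangle vectors have `7 / 2` times a Gram matrix of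
`E₈` as their Gram matrix (`HasSigns.false`). This is impossible: for `x ∈ X` let `e(x)` be `7 / 2`
times the norm of the projection of `x` to the span of these vectors. As `E₈` is even and
unimodular, `e(x)` is an even integer, so `e(x) ^ 2 ≥ 2 e(x)`, but by the design identities the sum
of `e` over `X` is `4032` and that of `e ^ 2` is `7840` (`DesignPair.false_of_unimodular`).
-/

noncomputable section

namespace StronglyPerfectLattice

/-! ### Linear forms on the sphere -/

section

open MeasureTheory Metric
open scoped Pointwise

/-- The self-map of the unit sphere induced by a linear isometry of `ℝⁿ`. -/
def sphereMap {n : ℕ} (φ : Euc n ≃ₗᵢ[ℝ] Euc n) (u : sphere (0 : Euc n) 1) :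
    sphere (0 : Euc n) 1 :=
  ⟨φ u, by simp⟩

theorem continuous_sphereMap {n : ℕ} (φ : Euc n ≃ₗᵢ[ℝ] Euc n) : Continuous (sphereMap φ) :=
  (φ.continuous.comp continuous_subtype_val).subtype_mk _

theorem map_sphereMap {n : ℕ} (φ : Euc n ≃ₗᵢ[ℝ] Euc n) :
    (volume : Measure (Euc n)).toSphere.map (sphereMap φ) =
      (volume : Measure (Euc n)).toSphere := by
  ext s hs
  have hm := (continuous_sphereMap φ).measurable
  rw [Measure.map_apply hm hs, Measure.toSphere_apply' _ (hm hs), Measure.toSphere_apply' _ hs]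
  congr 1
  have h : Set.Ioo (0 : ℝ) 1 • ((↑) '' (sphereMap φ ⁻¹' s) : Set (Euc n)) =
      φ ⁻¹' (Set.Ioo (0 : ℝ) 1 • ((↑) '' s : Set (Euc n))) := by
    ext v
    simp only [Set.mem_smul, Set.mem_image, Set.mem_preimage]
    constructor
    · rintro ⟨r, hr, _, ⟨u, hu, rfl⟩, rfl⟩
      exact ⟨r, hr, _, ⟨_, hu, rfl⟩, by simp [sphereMap]⟩
    · rintro ⟨r, hr, _, ⟨u, hu, rfl⟩, h⟩
      refine ⟨r, hr, _, ⟨sphereMap φ.symm u, ?_, rfl⟩, ?_⟩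
      · simpa [sphereMap] using hu
      · apply φ.injective
        simp [sphereMap, h]
  rw [h]
  exact φ.measurePreserving.measure_preimage_emb φ.toHomeomorph.measurableEmbedding _

/-- The average of a function over the unit sphere of `ℝⁿ`. -/
def sphereAvg {n : ℕ} (f : Euc n → ℝ) : ℝ :=
  ⨍ u : sphere (0 : Euc n) 1, f u ∂(volume : Measure (Euc n)).toSphere

theorem sphereAvg_comp {n : ℕ} (φ : Euc n ≃ₗᵢ[ℝ] Euc n) {f : Euc n → ℝ} (hf : Continuous f) :
    sphereAvg (fun u => f (φ u)) = sphereAvg f := by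
  unfold sphereAvg
  rw [average_eq, average_eq]
  congr 1
  conv_rhs => rw [← map_sphereMap φ]
  have hc : Continuous fun u : sphere (0 : Euc n) 1 => f u := hf.comp continuous_subtype_val
  rw [integral_map (continuous_sphereMap φ).measurable.aemeasurable hc.aestronglyMeasurable]
  rfl

theorem integrable_sphere {n : ℕ} {f : Euc n → ℝ} (hf : Continuous f) :
    Integrable (fun u : sphere (0 : Euc n) 1 => f u) (volume : Measure (Euc n)).toSphere :=
  (hf.comp continuous_subtype_val).integrable_of_hasCompactSupport
    (HasCompactSupport.of_compactSpace _)

theorem sphereAvg_add {n : ℕ} {f g : Euc n → ℝ} (hf : Continuous f) (hg : Continuous g) :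
    sphereAvg (fun u => f u + g u) = sphereAvg f + sphereAvg g := by
  simp only [sphereAvg, average_eq]
  rw [integral_add (integrable_sphere hf) (integrable_sphere hg), smul_add]

theorem sphereAvg_sum {n : ℕ} {ι : Type*} (s : Finset ι) {f : ι → Euc n → ℝ}
    (hf : ∀ i, Continuous (f i)) :
    sphereAvg (fun u => ∑ i ∈ s, f i u) = ∑ i ∈ s, sphereAvg (f i) := by
  simp only [sphereAvg, average_eq]
  rw [integral_finsetSum _ fun i _ => integrable_sphere (hf i), Finset.smul_sum]

theorem sphereAvg_const_mul {n : ℕ} (c : ℝ) (f : Euc n → ℝ) :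
    sphereAvg (fun u => c * f u) = c * sphereAvg f := by
  simp only [sphereAvg, average_eq]
  rw [integral_const_mul, smul_eq_mul, smul_eq_mul]; ring

theorem sphereAvg_eq_of_eqOn {n : ℕ} [NeZero n] {f : Euc n → ℝ} {c : ℝ}
    (h : ∀ u, ‖u‖ = 1 → f u = c) : sphereAvg f = c := by
  have hf : (fun u : sphere (0 : Euc n) 1 => f u) = fun _ => c := by
    ext u; exact h _ (by simp)
  have h0 : (volume : Measure (Euc n)).toSphere ≠ 0 := by
    exact Measure.toSphere_ne_zero _
  have : NeZero (volume : Measure (Euc n)).toSphere := ⟨h0⟩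
  rw [sphereAvg, hf, average_const]

theorem sphereAvg_inner_pow_eq {n : ℕ} (k : ℕ) {a b : Euc n} (h : ‖a‖ = ‖b‖) :
    sphereAvg (fun u => inner ℝ a u ^ k) = sphereAvg (fun u => inner ℝ b u ^ k) := by
  let φ := (ℝ ∙ (a - b))ᗮ.reflection
  have hb : φ a = b := Submodule.reflection_sub h
  rw [← sphereAvg_comp φ (f := fun u => inner ℝ b u ^ k) (by fun_prop)]
  congr 1; ext u
  rw [← hb, φ.inner_map_map]

theorem sphereAvg_inner_pow {n : ℕ} (k : ℕ) (i : Fin n) (a : Euc n) :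
    sphereAvg (fun u => inner ℝ a u ^ k) = ‖a‖ ^ k * sphereAvg (fun u : Euc n => u i ^ k) := by
  rw [sphereAvg_inner_pow_eq k (b := ‖a‖ • EuclideanSpace.single i (1 : ℝ)) (by simp [norm_smul]),
    ← sphereAvg_const_mul]
  congr 1; ext u
  rw [inner_smul_left, mul_pow]
  simp [EuclideanSpace.inner_single_left]

theorem norm_sq_eq_sum {n : ℕ} (u : Euc n) : ‖u‖ ^ 2 = ∑ i, u i ^ 2 := by
  rw [EuclideanSpace.norm_sq_eq]; simp

theorem sphereAvg_inner_sq {n : ℕ} [NeZero n] (a : Euc n) :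
    sphereAvg (fun u => inner ℝ a u ^ 2) = inner ℝ a a / n := by
  have h1 : sphereAvg (fun u : Euc n => ∑ i, u i ^ 2) = 1 :=
    sphereAvg_eq_of_eqOn fun u hu => by rw [← norm_sq_eq_sum, hu, one_pow]
  rw [sphereAvg_sum _ (by fun_prop)] at h1
  have h2 : ∀ i : Fin n, sphereAvg (fun u : Euc n => u i ^ 2)
      = sphereAvg (fun u : Euc n => u 0 ^ 2) := fun i => by
    have := sphereAvg_inner_pow 2 (0 : Fin n) (EuclideanSpace.single i (1 : ℝ))
    simpa [EuclideanSpace.inner_single_left] using this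
  simp only [h2, Finset.sum_const, Finset.card_univ, Fintype.card_fin, nsmul_eq_mul] at h1
  rw [sphereAvg_inner_pow 2 0, real_inner_self_eq_norm_sq]
  have hn : (n : ℝ) ≠ 0 := NeZero.ne _
  field_simp
  linear_combination ‖a‖ ^ 2 * h1

theorem sphereAvg_inner_pow_four {n : ℕ} [NeZero n] (a : Euc n) :
    sphereAvg (fun u => inner ℝ a u ^ 4) = 3 * inner ℝ a a ^ 2 / (n * (n + 2)) := by
  set c := sphereAvg (fun u : Euc n => u 0 ^ 4) with hc
  have h2 : ∀ i : Fin n, sphereAvg (fun u : Euc n => u i ^ 4) = c := fun i => by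
    have := sphereAvg_inner_pow 4 (0 : Fin n) (EuclideanSpace.single i (1 : ℝ))
    simpa [EuclideanSpace.inner_single_left] using this
  -- the mixed moments come from `(u_i + u_j) ^ 4 + (u_i - u_j) ^ 4`
  have h3 : ∀ i j : Fin n, sphereAvg (fun u : Euc n => u i ^ 2 * u j ^ 2) =
      if i = j then c else c / 3 := by
    intro i j
    split_ifs with hij
    · subst hij; rw [← h2 i]; congr 1; ext u; ring
    have hp := sphereAvg_inner_pow 4 0
      (EuclideanSpace.single i (1 : ℝ) + EuclideanSpace.single j (1 : ℝ))
    have hm := sphereAvg_inner_pow 4 0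
      (EuclideanSpace.single i (1 : ℝ) - EuclideanSpace.single j (1 : ℝ))
    have np : ‖EuclideanSpace.single i (1 : ℝ) + EuclideanSpace.single j (1 : ℝ)‖ ^ 4 = 4 := by
      rw [show 4 = 2 * 2 from rfl, pow_mul, norm_add_sq_real]
      simp [hij, EuclideanSpace.inner_single_left]; norm_num
    have nm : ‖EuclideanSpace.single i (1 : ℝ) - EuclideanSpace.single j (1 : ℝ)‖ ^ 4 = 4 := by
      rw [show 4 = 2 * 2 from rfl, pow_mul, norm_sub_sq_real]
      simp [hij, EuclideanSpace.inner_single_left]; norm_num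
    rw [np] at hp
    rw [nm] at hm
    simp only [inner_add_left, inner_sub_left, EuclideanSpace.inner_single_left, map_one,
      one_mul] at hp hm
    have hs : sphereAvg (fun u : Euc n => (u i + u j) ^ 4 + (u i - u j) ^ 4) = 8 * c := by
      rw [sphereAvg_add (by fun_prop) (by fun_prop), hp, hm]; ring
    have he : (fun u : Euc n => (u i + u j) ^ 4 + (u i - u j) ^ 4) =
        fun u => (2 * u i ^ 4 + 2 * u j ^ 4) + 12 * (u i ^ 2 * u j ^ 2) := by
      ext u; ring
    rw [he, sphereAvg_add (by fun_prop) (by fun_prop), sphereAvg_add (by fun_prop) (by fun_prop),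
      sphereAvg_const_mul, sphereAvg_const_mul, sphereAvg_const_mul, h2, h2] at hs
    linarith
  have h1 : sphereAvg (fun u : Euc n => ∑ i, ∑ j, u i ^ 2 * u j ^ 2) = 1 :=
    sphereAvg_eq_of_eqOn fun u hu => by
      rw [← Finset.sum_mul_sum, ← norm_sq_eq_sum, hu]; norm_num
  rw [sphereAvg_sum _ (by fun_prop)] at h1
  have h4 : ∀ i : Fin n, sphereAvg (fun u : Euc n => ∑ j, u i ^ 2 * u j ^ 2) =
      c * (2 / 3) + n * (c / 3) := by
    intro i
    rw [sphereAvg_sum _ (by fun_prop)]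
    simp only [h3]
    have : ∀ j : Fin n, (if i = j then c else c / 3) =
        (if i = j then c * (2 / 3) else 0) + c / 3 := by
      intro j; split_ifs <;> ring
    simp [this, Finset.sum_add_distrib]
  simp only [h4, Finset.sum_const, Finset.card_univ, Fintype.card_fin, nsmul_eq_mul] at h1
  rw [sphereAvg_inner_pow 4 0, real_inner_self_eq_norm_sq, ← hc]
  have hn : (n : ℝ) ≠ 0 := NeZero.ne _
  have hn2 : (n : ℝ) + 2 ≠ 0 := by positivity
  field_simp
  linear_combination 3 * ‖a‖ ^ 4 * h1

/-- A `t`-design of radius `R` averages even powers of linear forms as the sphere does. -/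
theorem IsSphericalDesign.sum_inner_pow {n t k : ℕ} {R : ℝ} {X : Set (Euc n)}
    (h : IsSphericalDesign t R X) (hk : k ≤ t) (v : Euc n) :
    ∑ x ∈ h.finite.toFinset, inner ℝ x v ^ k =
      h.finite.toFinset.card * (R ^ k * sphereAvg fun u => inner ℝ v u ^ k) := by
  classical
  let p : MvPolynomial (Fin n) ℝ := (∑ i, MvPolynomial.C (v i) * MvPolynomial.X i) ^ k
  have hp : p.totalDegree ≤ t := by
    refine (MvPolynomial.totalDegree_pow _ _).trans ?_
    have : (∑ i, MvPolynomial.C (v i) * MvPolynomial.X i : MvPolynomial (Fin n) ℝ).totalDegree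
        ≤ 1 := by
      refine MvPolynomial.totalDegree_finsetSum_le fun i _ => ?_
      refine (MvPolynomial.totalDegree_mul _ _).trans ?_
      simp
    nlinarith
  have hev : ∀ x : Fin n → ℝ, MvPolynomial.eval x p = (∑ i, v i * x i) ^ k := by
    intro x; simp [p]
  have key := h.average_eq p hp
  simp only [hev] at key
  have hi : ∀ x : Euc n, ∑ i, v i * x i = inner ℝ v x := by
    intro x; simp [PiLp.inner_apply, mul_comm]
  have hR : ∀ x : Euc n, ∑ i, v i * (R * x i) = R * inner ℝ v x := by
    intro x; rw [← hi, Finset.mul_sum]; congr 1; ext i; ring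
  simp only [hR, mul_pow] at key
  rw [show (⨍ u : sphere (0 : Euc n) 1, R ^ k * inner ℝ v (u : Euc n) ^ k
      ∂(volume : Measure (Euc n)).toSphere) =
      sphereAvg (fun u => R ^ k * inner ℝ v u ^ k) from rfl, sphereAvg_const_mul] at key
  rw [← key, finsum_mem_eq_finite_toFinset_sum _ h.finite, Set.ncard_eq_toFinset_card X h.finite]
  have hc : (h.finite.toFinset.card : ℝ) ≠ 0 := by
    have : h.finite.toFinset.Nonempty := by simpa using h.nonempty
    exact_mod_cast this.card_pos.ne'
  rw [mul_div_cancel₀ _ hc]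
  refine Finset.sum_congr rfl fun x _ => ?_
  rw [hi, real_inner_comm]

end

/-! ### The two sets of minimal vectors -/

/-- The data left of a dual strongly perfect lattice of dimension `16` and its dual when
`min(L) min(L*) = 7`: two groups of vectors with integral inner products between them, of minimum
`μ` and `ν`, whose sets `X` and `Y` of minimal vectors satisfy the identities of degree `2` and `4`
of a spherical design in `ℝ¹⁶`. The definition is symmetric in the two sides. -/
structure DesignPair {E : Type*} [NormedAddCommGroup E] [InnerProductSpace ℝ E]
    (A B : AddSubgroup E) (X Y : Finset E) (μ ν : ℝ) : Prop where
  int : ∀ a ∈ A, ∀ b ∈ B, ∃ k : ℤ, inner ℝ a b = (k : ℝ)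
  mul_eq : μ * ν = 7
  pos_left : 0 < μ
  pos_right : 0 < ν
  min_left : ∀ a ∈ A, a ≠ 0 → μ ≤ inner ℝ a a
  min_right : ∀ b ∈ B, b ≠ 0 → ν ≤ inner ℝ b b
  mem_left : ∀ x, x ∈ X ↔ x ∈ A ∧ inner ℝ x x = μ
  mem_right : ∀ y, y ∈ Y ↔ y ∈ B ∧ inner ℝ y y = ν
  nonempty_left : X.Nonempty
  nonempty_right : Y.Nonempty
  sum_sq_left : ∀ v, ∑ x ∈ X, inner ℝ x v ^ 2 = X.card * μ / 16 * inner ℝ v v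
  sum_sq_right : ∀ v, ∑ y ∈ Y, inner ℝ y v ^ 2 = Y.card * ν / 16 * inner ℝ v v
  sum_four_left : ∀ v, ∑ x ∈ X, inner ℝ x v ^ 4 = X.card * μ ^ 2 / 96 * inner ℝ v v ^ 2
  sum_four_right : ∀ v, ∑ y ∈ Y, inner ℝ y v ^ 4 = Y.card * ν ^ 2 / 96 * inner ℝ v v ^ 2

namespace DesignPair

variable {E : Type*} [NormedAddCommGroup E] [InnerProductSpace ℝ E]
  {A B : AddSubgroup E} {X Y : Finset E} {μ ν : ℝ}

theorem symm (h : DesignPair A B X Y μ ν) : DesignPair B A Y X ν μ where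
  int b hb a ha := by
    obtain ⟨k, hk⟩ := h.int a ha b hb
    exact ⟨k, by rw [real_inner_comm, hk]⟩
  mul_eq := by rw [mul_comm, h.mul_eq]
  pos_left := h.pos_right
  pos_right := h.pos_left
  min_left := h.min_right
  min_right := h.min_left
  mem_left := h.mem_right
  mem_right := h.mem_left
  nonempty_left := h.nonempty_right
  nonempty_right := h.nonempty_left
  sum_sq_left := h.sum_sq_right
  sum_sq_right := h.sum_sq_left
  sum_four_left := h.sum_four_right
  sum_four_right := h.sum_four_left

theorem neg_mem_left (h : DesignPair A B X Y μ ν) {x : E} (hx : x ∈ X) : -x ∈ X := by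
  rw [h.mem_left] at hx ⊢
  exact ⟨neg_mem hx.1, by simpa using hx.2⟩

theorem inner_le_left (h : DesignPair A B X Y μ ν) {x x' : E} (hx : x ∈ X) (hx' : x' ∈ X)
    (hne : x ≠ x') : inner ℝ x x' ≤ μ / 2 := by
  rw [h.mem_left] at hx hx'
  have := h.min_left (x - x') (sub_mem hx.1 hx'.1) (sub_ne_zero.2 hne)
  rw [real_inner_sub_sub_self, hx.2, hx'.2] at this
  linarith

theorem inner_le_right (h : DesignPair A B X Y μ ν) {y y' : E} (hy : y ∈ Y) (hy' : y' ∈ Y)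
    (hne : y ≠ y') : inner ℝ y y' ≤ ν / 2 :=
  h.symm.inner_le_left hy hy' hne

theorem int_le_two (h : DesignPair A B X Y μ ν) {x y : E} (hx : x ∈ X) (hy : y ∈ Y) :
    ∃ k : ℤ, inner ℝ x y = (k : ℝ) ∧ -2 ≤ k ∧ k ≤ 2 := by
  rw [h.mem_left] at hx
  rw [h.mem_right] at hy
  obtain ⟨k, hk⟩ := h.int x hx.1 y hy.1
  have hc := real_inner_mul_inner_self_le x y
  rw [hk, hx.2, hy.2, h.mul_eq] at hc
  have hc' : k * k ≤ 7 := by exact_mod_cast hc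
  exact ⟨k, hk, by nlinarith, by nlinarith⟩

open Classical in
/-- The vectors of `X` having the largest possible inner product `2` with `y`. -/
def twos (X : Finset E) (y : E) : Finset E := X.filter fun x => inner ℝ x y = 2

theorem mem_twos {x y : E} : x ∈ twos X y ↔ x ∈ X ∧ inner ℝ x y = 2 := by
  simp [twos]

theorem sum_odd_eq_zero (h : DesignPair A B X Y μ ν) {f : E → ℝ} (hf : ∀ x, f (-x) = -f x) :
    ∑ x ∈ X, f x = 0 := by
  have : ∑ x ∈ X, f x = ∑ x ∈ X, f (-x) :=
    Finset.sum_nbij' (fun x => -x) (fun x => -x) (fun x hx => h.neg_mem_left hx)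
      (fun x hx => h.neg_mem_left hx) (by simp) (by simp) (by simp)
  simp only [hf, Finset.sum_neg_distrib] at this
  linarith

/-- The ratio of `(twos X y).card` and `X.card`, from the identities of degree `2` and `4`. -/
theorem card_twos_eq (h : DesignPair A B X Y μ ν) {y : E} (hy : y ∈ Y) :
    ((twos X y).card : ℝ) * 2304 = 7 * X.card := by
  classical
  -- `k ^ 4 - k ^ 2 + 2 (k ^ 3 - k)` vanishes at `-2, -1, 0, 1` and is `24` at `2`
  have h1 : ∀ x ∈ X, (if inner ℝ x y = 2 then (24 : ℝ) else 0) =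
      inner ℝ x y ^ 4 - inner ℝ x y ^ 2 + (2 * inner ℝ x y ^ 3 - 2 * inner ℝ x y) := by
    intro x hx
    obtain ⟨k, hk, h1, h2⟩ := h.int_le_two hx hy
    rw [hk]
    interval_cases k <;> norm_num
  have h2 := Finset.sum_congr rfl h1
  rw [Finset.sum_add_distrib, Finset.sum_sub_distrib, h.sum_four_left, h.sum_sq_left,
    h.sum_odd_eq_zero (f := fun x => 2 * inner ℝ x y ^ 3 - 2 * inner ℝ x y)
      (fun x => by simp only [inner_neg_left]; ring), ← Finset.sum_filter,
    Finset.sum_const, nsmul_eq_mul, ((h.mem_right y).1 hy).2] at h2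
  have h3 : ((twos X y).card : ℝ) * 24 =
      X.card * (μ * ν) ^ 2 / 96 - X.card * (μ * ν) / 16 := by
    rw [twos, h2]; ring
  rw [h.mul_eq] at h3
  linarith

theorem sum_inner_sq_twos (h : DesignPair A B X Y μ ν) {y : E} (hy : y ∈ Y) :
    (2 * (twos X y).card : ℝ) ^ 2 ≤
      inner ℝ (∑ x ∈ twos X y, x) (∑ x ∈ twos X y, x) * ν := by
  have h1 : inner ℝ (∑ x ∈ twos X y, x) y = 2 * ((twos X y).card : ℝ) := by
    rw [sum_inner, Finset.sum_congr rfl fun x hx => (mem_twos.1 hx).2]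
    simp [mul_comm]
  have h2 := real_inner_mul_inner_self_le (∑ x ∈ twos X y, x) y
  rw [h1, ((h.mem_right y).1 hy).2] at h2
  linarith [h2]

theorem inner_twos_le (h : DesignPair A B X Y μ ν) {y x x' : E} (hx : x ∈ twos X y)
    (hx' : x' ∈ twos X y) :
    inner ℝ x x' ≤ μ / 2 + open Classical in if x = x' then μ / 2 else 0 := by
  rw [mem_twos] at hx hx'
  split_ifs with he
  · subst he; rw [((h.mem_left x).1 hx.1).2]; linarith
  · simpa using h.inner_le_left hx.1 hx'.1 he

open Classical in
theorem sum_inner_bound {α : Type*} (μ : ℝ) (s : Finset α) :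
    ∑ x ∈ s, ∑ x' ∈ s, (μ / 2 + if x = x' then μ / 2 else 0) = μ * (s.card * (s.card + 1)) / 2 := by
  simp [Finset.sum_add_distrib]
  ring

theorem sum_inner_sum_self (s : Finset E) :
    inner ℝ (∑ x ∈ s, x) (∑ x ∈ s, x) = ∑ x ∈ s, ∑ x' ∈ s, inner ℝ x x' := by
  rw [sum_inner]
  simp only [inner_sum]

/-- The vectors of `twos X y` have pairwise inner products at most `μ / 2`, so by Cauchy–Schwarz
there are at most seven; their number is a positive multiple of `7` by `card_twos_eq`. -/
theorem card_twos_and_card (h : DesignPair A B X Y μ ν) {y : E} (hy : y ∈ Y) :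
    (twos X y).card = 7 ∧ X.card = 2304 := by
  have h1 := h.card_twos_eq hy
  have h2 := h.sum_inner_sq_twos hy
  have h3 : inner ℝ (∑ x ∈ twos X y, x) (∑ x ∈ twos X y, x) ≤
      μ * ((twos X y).card * ((twos X y).card + 1)) / 2 := by
    classical
    rw [← sum_inner_bound, sum_inner_sum_self]
    exact Finset.sum_le_sum fun x hx => Finset.sum_le_sum fun x' hx' => h.inner_twos_le hx hx'
  have h4 : (2 * (twos X y).card : ℝ) ^ 2 ≤
      μ * ν * ((twos X y).card * ((twos X y).card + 1)) / 2 := by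
    nlinarith [mul_le_mul_of_nonneg_right h3 h.pos_right.le]
  rw [h.mul_eq] at h4
  have hN := h.nonempty_left.card_pos
  have h1' : (twos X y).card * 2304 = 7 * X.card := by exact_mod_cast h1
  have h5 : (twos X y).card ≤ 7 := by
    by_contra! hc
    have : (8 : ℝ) ≤ (twos X y).card := by exact_mod_cast hc
    nlinarith
  omega

theorem card_twos (h : DesignPair A B X Y μ ν) {y : E} (hy : y ∈ Y) : (twos X y).card = 7 :=
  (h.card_twos_and_card hy).1

theorem card_left (h : DesignPair A B X Y μ ν) : X.card = 2304 :=
  (h.card_twos_and_card h.nonempty_right.choose_spec).2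

/-- The Cauchy-Schwarz bound is attained by the sum of the seven vectors of `twos X y`. -/
theorem inner_sum_twos (h : DesignPair A B X Y μ ν) {y : E} (hy : y ∈ Y) :
    28 * μ ≤ inner ℝ (∑ x ∈ twos X y, x) (∑ x ∈ twos X y, x) := by
  have h2 := h.sum_inner_sq_twos hy
  rw [h.card_twos hy] at h2
  have h3 : 28 * μ * ν ≤ inner ℝ (∑ x ∈ twos X y, x) (∑ x ∈ twos X y, x) * ν := by
    rw [mul_assoc, h.mul_eq]; push_cast at h2; linarith
  exact le_of_mul_le_mul_right h3 h.pos_right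

theorem inner_twos (h : DesignPair A B X Y μ ν) {y x x' : E} (hy : y ∈ Y) (hx : x ∈ twos X y)
    (hx' : x' ∈ twos X y) (hne : x ≠ x') : inner ℝ x x' = μ / 2 := by
  classical
  have h1 := h.inner_sum_twos hy
  have h2 := sum_inner_bound μ (twos X y)
  rw [h.card_twos hy] at h2
  rw [sum_inner_sum_self] at h1
  by_contra hc
  have hlt : inner ℝ x x' < μ / 2 + if x = x' then μ / 2 else 0 :=
    lt_of_le_of_ne (h.inner_twos_le hx hx') (by simpa [hne] using hc)
  have : ∑ x ∈ twos X y, ∑ x' ∈ twos X y, inner ℝ x x' <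
      ∑ x ∈ twos X y, ∑ x' ∈ twos X y, (μ / 2 + if x = x' then μ / 2 else 0) :=
    Finset.sum_lt_sum
      (fun x hx => Finset.sum_le_sum fun x' hx' => h.inner_twos_le hx hx')
      ⟨x, hx, Finset.sum_lt_sum (fun x' hx' => h.inner_twos_le hx hx') ⟨x', hx', hlt⟩⟩
  push_cast at h2
  linarith

theorem sum_twos (h : DesignPair A B X Y μ ν) {y : E} (hy : y ∈ Y) :
    ∑ x ∈ twos X y, x = (2 * μ) • y := by
  have hS : inner ℝ (∑ x ∈ twos X y, x) y = 14 := by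
    rw [sum_inner, Finset.sum_congr rfl fun x hx => (mem_twos.1 hx).2]
    simp [h.card_twos hy]; norm_num
  have h3 : inner ℝ (∑ x ∈ twos X y, x) (∑ x ∈ twos X y, x) ≤ 28 * μ := by
    classical
    have := sum_inner_bound μ (twos X y)
    rw [h.card_twos hy] at this
    rw [sum_inner_sum_self, show 28 * μ = μ * ((7 : ℕ) * ((7 : ℕ) + 1)) / 2 by push_cast; ring,
      ← this]
    exact Finset.sum_le_sum fun x hx => Finset.sum_le_sum fun x' hx' => h.inner_twos_le hx hx'
  rw [← sub_eq_zero, ← real_inner_self_nonpos]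
  rw [real_inner_sub_sub_self, inner_smul_left, inner_smul_right, inner_smul_right, hS,
    ((h.mem_right y).1 hy).2]
  have := h.mul_eq
  simp only [conj_trivial]
  have e : 2 * μ * (2 * μ * ν) = 28 * μ := by linear_combination 4 * μ * this
  linarith

/-- When the minimum of `A` is `1`, the group `B` has integral norms. With `w = 144 (b, b)` the sum
of the squares of the integers `(x, b)`, divisibility of `k ^ 4 - k ^ 2` by `12` shows that
`(w - 432) ^ 2` is `72 ^ 2` times an even integer. -/
theorem int_norm (h : DesignPair A B X Y 1 ν) {b : E} (hb : b ∈ B) :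
    ∃ k : ℤ, inner ℝ b b = (k : ℝ) := by
  have h2 := h.sum_sq_left b
  have h4 := h.sum_four_left b
  rw [h.card_left] at h2 h4
  have hk : ∀ x : E, ∃ k : ℤ, x ∈ X → inner ℝ x b = (k : ℝ) := fun x => by
    by_cases hx : x ∈ X
    · obtain ⟨k, hk⟩ := h.int x ((h.mem_left x).1 hx).1 b hb
      exact ⟨k, fun _ => hk⟩
    · exact ⟨0, fun h => (hx h).elim⟩
  choose k hk using hk
  have h12 : ∀ n : ℤ, ∃ z, n ^ 4 - n ^ 2 = 12 * z := by
    intro n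
    have : ((n ^ 4 - n ^ 2 : ℤ) : ZMod 12) = 0 := by
      push_cast
      generalize (n : ZMod 12) = m
      revert m; decide
    exact (ZMod.intCast_zmod_eq_zero_iff_dvd _ 12).1 this
  choose z hz using h12
  have e2 : (∑ x ∈ X, (k x : ℝ) ^ 2) = 144 * inner ℝ b b := by
    rw [Finset.sum_congr rfl fun x hx => by rw [← hk x hx], h2]; norm_num
  have e4 : (∑ x ∈ X, (k x : ℝ) ^ 4) = 24 * inner ℝ b b ^ 2 := by
    rw [Finset.sum_congr rfl fun x hx => by rw [← hk x hx], h4]; norm_num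
  set w : ℤ := ∑ x ∈ X, k x ^ 2 with hw
  set v : ℤ := ∑ x ∈ X, z (k x) with hv
  have e3 : (∑ x ∈ X, k x ^ 4) - w = 12 * v := by
    rw [hw, hv, ← Finset.sum_sub_distrib, Finset.mul_sum]
    exact Finset.sum_congr rfl fun x _ => hz _
  have e2' : (w : ℝ) = 144 * inner ℝ b b := by rw [← e2, hw]; push_cast; rfl
  have e4' : 24 * inner ℝ b b ^ 2 - (w : ℝ) = 12 * v := by
    rw [← e4]; exact_mod_cast e3
  have e5 : (w - 432) ^ 2 = 72 ^ 2 * (36 + 2 * v) := by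
    have : ((w : ℝ) - 432) ^ 2 = 72 ^ 2 * (36 + 2 * v) := by rw [e2'] at e4' ⊢; linarith
    exact_mod_cast this
  obtain ⟨r, hr⟩ : (72 : ℤ) ∣ w - 432 :=
    (Int.pow_dvd_pow_iff two_ne_zero).1 ⟨_, e5⟩
  rw [hr] at e5
  have e6 : r ^ 2 = 2 * (18 + v) := by linarith
  have h2r : (2 : ℤ) ∣ r := Int.prime_two.dvd_of_dvd_pow ⟨_, e6⟩
  obtain ⟨s, rfl⟩ := h2r
  refine ⟨s + 3, ?_⟩
  have : (w : ℝ) = 432 + 144 * s := by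
    have : w = 432 + 144 * s := by linarith
    exact_mod_cast this
  push_cast
  linarith

theorem int_two_mul_inner (h : DesignPair A B X Y 1 ν) {b c : E} (hb : b ∈ B) (hc : c ∈ B) :
    ∃ k : ℤ, 2 * inner ℝ b c = (k : ℝ) := by
  obtain ⟨k, hk⟩ := h.int_norm hb
  obtain ⟨l, hl⟩ := h.int_norm hc
  obtain ⟨m, hm⟩ := h.int_norm (add_mem hb hc)
  refine ⟨m - k - l, ?_⟩
  rw [real_inner_add_add_self] at hm
  push_cast
  linarith

end DesignPair

/-- The vectors `x` with `c • x` in a given `4`-design form a `4`-design of radius `R / c`. -/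
theorem IsSphericalDesign.exists_rescaled {n : ℕ} [NeZero n] {R c : ℝ} {F : Set (Euc n)}
    (h : IsSphericalDesign 4 R F) (hc : c ≠ 0) :
    ∃ X : Finset (Euc n), (∀ x, x ∈ X ↔ c • x ∈ F) ∧ X.Nonempty ∧
      (∀ v, ∑ x ∈ X, inner ℝ x v ^ 2 = X.card * (R / c) ^ 2 / n * inner ℝ v v) ∧
      (∀ v, ∑ x ∈ X, inner ℝ x v ^ 4 =
        X.card * ((R / c) ^ 2) ^ 2 * 3 / (n * (n + 2)) * inner ℝ v v ^ 2) := by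
  classical
  have hinj : Function.Injective fun x : Euc n => c⁻¹ • x := smul_right_injective _ (inv_ne_zero hc)
  refine ⟨h.finite.toFinset.image fun x => c⁻¹ • x, fun x => ?_, ?_, fun v => ?_, fun v => ?_⟩
  · simp only [Finset.mem_image, Set.Finite.mem_toFinset]
    constructor
    · rintro ⟨y, hy, rfl⟩
      rwa [smul_inv_smul₀ hc]
    · intro hx
      exact ⟨_, hx, inv_smul_smul₀ hc x⟩
  · simpa using h.nonempty
  · rw [Finset.sum_image hinj.injOn, Finset.card_image_of_injective _ hinj]
    simp only [inner_smul_left, mul_pow, conj_trivial]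
    rw [← Finset.mul_sum, h.sum_inner_pow (by norm_num), sphereAvg_inner_sq]
    field_simp
  · rw [Finset.sum_image hinj.injOn, Finset.card_image_of_injective _ hinj]
    simp only [inner_smul_left, mul_pow, conj_trivial]
    rw [← Finset.mul_sum, h.sum_inner_pow le_rfl, sphereAvg_inner_pow_four]
    field_simp

theorem minimum_le {n : ℕ} {L : Submodule ℤ (Euc n)} {x : Euc n} (hx : x ∈ L) (h0 : x ≠ 0) :
    minimum L ≤ inner ℝ x x :=
  csInf_le ⟨0, by rintro _ ⟨y, _, _, rfl⟩; exact real_inner_self_nonneg⟩ ⟨x, hx, h0, rfl⟩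

/-- Rescaling a dual strongly perfect lattice in `ℝ¹⁶` with `r(L) = 7`, its minimum can be taken
to be `1` and that of its dual to be `7`. -/
theorem IsDualStronglyPerfect.exists_designPair {L : Submodule ℤ (Euc 16)}
    (hL : IsDualStronglyPerfect L) (hr : bergeMartinet L = 7) :
    ∃ (A B : AddSubgroup (Euc 16)) (X Y : Finset (Euc 16)), DesignPair A B X Y 1 7 := by
  obtain ⟨h1, h2⟩ := hL
  have p1 : 0 < minimum L := Real.sqrt_pos.1 h1.radius_pos
  have p2 : 0 < minimum (dual L) := Real.sqrt_pos.1 h2.radius_pos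
  have hr' : minimum L * minimum (dual L) = 7 := hr
  set s := Real.sqrt (minimum L) with hs
  have s0 : s ≠ 0 := h1.radius_pos.ne'
  have ss : s ^ 2 = minimum L := Real.sq_sqrt p1.le
  obtain ⟨X, mX, nX, X2, X4⟩ := h1.exists_rescaled s0
  obtain ⟨Y, mY, nY, Y2, Y4⟩ := h2.exists_rescaled (inv_ne_zero s0)
  have e1 : (s / s) ^ 2 = 1 := by rw [div_self s0, one_pow]
  have e2 : (Real.sqrt (minimum (dual L)) / s⁻¹) ^ 2 = 7 := by
    rw [div_inv_eq_mul, mul_pow, ss, Real.sq_sqrt p2.le, mul_comm, hr']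
  have hA : ∀ a : Euc 16, inner ℝ (s • a) (s • a) = minimum L * inner ℝ a a := by
    intro a
    rw [inner_smul_left, inner_smul_right, ← ss, conj_trivial]; ring
  have hB : ∀ b : Euc 16, inner ℝ (s⁻¹ • b) (s⁻¹ • b) = minimum (dual L) / 7 * inner ℝ b b := by
    intro b
    rw [inner_smul_left, inner_smul_right, conj_trivial, ← hr', ← ss]
    field_simp
  refine ⟨L.toAddSubgroup.comap (DistribSMul.toAddMonoidHom (Euc 16) s),
    (dual L).toAddSubgroup.comap (DistribSMul.toAddMonoidHom (Euc 16) s⁻¹), X, Y,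
    { int := ?_
      mul_eq := by norm_num
      pos_left := by norm_num
      pos_right := by norm_num
      min_left := ?_
      min_right := ?_
      mem_left := ?_
      mem_right := ?_
      nonempty_left := nX
      nonempty_right := nY
      sum_sq_left := ?_
      sum_sq_right := ?_
      sum_four_left := ?_
      sum_four_right := ?_ }⟩
  · intro a ha b hb
    obtain ⟨k, hk⟩ := (mem_dual_iff L _).1 hb _ ha
    refine ⟨k, ?_⟩
    rw [← hk]
    simp [inner_smul_left, inner_smul_right, real_inner_comm, s0]
  · intro a ha h0
    have := minimum_le (x := s • a) ha (smul_ne_zero s0 h0)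
    rw [hA] at this
    nlinarith
  · intro b hb h0
    have hb' : s⁻¹ • b ∈ dual L := hb
    have := minimum_le hb' (smul_ne_zero (inv_ne_zero s0) h0)
    rw [hB] at this
    nlinarith
  · intro x
    rw [mX]
    refine and_congr Iff.rfl ?_
    rw [hA]
    constructor
    · intro h; exact mul_left_cancel₀ p1.ne' (by rw [h, mul_one])
    · intro h; rw [h, mul_one]
  · intro y
    rw [mY]
    refine and_congr Iff.rfl ?_
    rw [hB]
    constructor
    · intro h; exact mul_left_cancel₀ (div_pos p2 (by norm_num : (0 : ℝ) < 7)).ne' (by linarith)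
    · intro h; rw [h]; ring
  · intro v; rw [X2, e1]; norm_num
  · intro v; rw [Y2, e2]; norm_num
  · intro v; rw [X4, e1]; push_cast; ring
  · intro v; rw [Y4, e2]; push_cast; ring

/-! ### Inner product two, and the absence of the root lattice `E₈` -/

namespace DesignPair

variable {E : Type*} [NormedAddCommGroup E] [InnerProductSpace ℝ E]
  {A B : AddSubgroup E} {X Y : Finset E} {ν : ℝ}

theorem sum_inner_mul_inner (h : DesignPair A B X Y 1 ν) (a b : E) :
    ∑ x ∈ X, inner ℝ x a * inner ℝ x b = 144 * inner ℝ a b := by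
  have hp := h.sum_sq_left (a + b)
  have hm := h.sum_sq_left (a - b)
  rw [h.card_left, real_inner_add_add_self] at hp
  rw [h.card_left, real_inner_sub_sub_self] at hm
  have : ∑ x ∈ X, inner ℝ x a * inner ℝ x b =
      (∑ x ∈ X, inner ℝ x (a + b) ^ 2 - ∑ x ∈ X, inner ℝ x (a - b) ^ 2) / 4 := by
    rw [← Finset.sum_sub_distrib, Finset.sum_div]
    refine Finset.sum_congr rfl fun x _ => ?_
    rw [inner_add_right, inner_sub_right]; ring
  rw [this, hp, hm]
  push_cast; ring

theorem sum_inner_mul_four (h : DesignPair A B X Y 1 ν) (a b c d : E) :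
    ∑ x ∈ X, inner ℝ x a * inner ℝ x b * (inner ℝ x c * inner ℝ x d) =
      8 * (inner ℝ a b * inner ℝ c d + inner ℝ a c * inner ℝ b d + inner ℝ a d * inner ℝ b c) := by
  have hq : ∀ v, ∑ x ∈ X, inner ℝ x v ^ 4 = 24 * inner ℝ v v ^ 2 := fun v => by
    rw [h.sum_four_left, h.card_left]; norm_num
  have : ∑ x ∈ X, inner ℝ x a * inner ℝ x b * (inner ℝ x c * inner ℝ x d) =
      (∑ x ∈ X, inner ℝ x (a + b + c + d) ^ 4 - ∑ x ∈ X, inner ℝ x (a + b + c - d) ^ 4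
      - ∑ x ∈ X, inner ℝ x (a + b - c + d) ^ 4 + ∑ x ∈ X, inner ℝ x (a + b - c - d) ^ 4
      - ∑ x ∈ X, inner ℝ x (a - b + c + d) ^ 4 + ∑ x ∈ X, inner ℝ x (a - b + c - d) ^ 4
      + ∑ x ∈ X, inner ℝ x (a - b - c + d) ^ 4 - ∑ x ∈ X, inner ℝ x (a - b - c - d) ^ 4) / 192 := by
    simp only [← Finset.sum_sub_distrib, ← Finset.sum_add_distrib]
    rw [Finset.sum_div]
    refine Finset.sum_congr rfl fun x _ => ?_
    simp only [inner_add_right, inner_sub_right]; ring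
  rw [this]
  simp only [hq]
  simp only [inner_add_right, inner_sub_right, inner_add_left, inner_sub_left]
  rw [real_inner_comm b a, real_inner_comm c a, real_inner_comm d a, real_inner_comm c b,
    real_inner_comm d b, real_inner_comm d c]
  ring

/-- A copy of `√(7/2)` times an even unimodular lattice of rank `8` in `B` is incompatible with
the design property: with `p` the orthogonal projection onto its span, the numbers
`e(x) = (7/2) (p x, p x)`, for `x ∈ X`, are norms in an even unimodular lattice, so even integers,
whence `e(x) ^ 2 ≥ 2 e(x)`; but the sums of `e` and of `e ^ 2` over `X` are `4032` and `7840`.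
The inverse Gram matrix is given in the form `U + Uᵀ`, which makes it even. -/
theorem false_of_unimodular (h : DesignPair A B X Y 1 ν) (g : Fin 8 → E) (hg : ∀ i, g i ∈ B)
    (G U : Matrix (Fin 8) (Fin 8) ℤ) (hG : ∀ i j, inner ℝ (g i) (g j) = 7 / 2 * (G i j : ℝ))
    (hU : G * (U + U.transpose) = 1) : False := by
  classical
  set H : Matrix (Fin 8) (Fin 8) ℤ := U + U.transpose with hH
  have hHs : ∀ i j, H i j = H j i := fun i j => by simp [hH, add_comm]
  have hGs : ∀ i j, G i j = G j i := fun i j => by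
    have : (G i j : ℝ) = G j i := by
      have := hG i j
      rw [real_inner_comm, hG j i] at this; linarith
    exact_mod_cast this
  have hGH : ∀ i l, ∑ j, G i j * H j l = if i = l then 1 else 0 := fun i l => by
    rw [← Matrix.mul_apply, hU, Matrix.one_apply]
  let e : E → ℝ := fun x => ∑ i, ∑ j, (H i j : ℝ) * (inner ℝ x (g i) * inner ℝ x (g j))
  have he : ∀ x ∈ X, 2 * e x ≤ e x ^ 2 := by
    intro x hx
    choose k hk using fun i => h.int x ((h.mem_left x).1 hx).1 (g i) (hg i)
    have : e x = 2 * ((∑ i, ∑ j, U i j * (k i * k j) : ℤ) : ℝ) := by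
      have h2 : ∑ i, ∑ j, U j i * (k i * k j) = ∑ i, ∑ j, U i j * (k i * k j) := by
        rw [Finset.sum_comm]
        exact Finset.sum_congr rfl fun i _ => Finset.sum_congr rfl fun j _ => by ring
      have h3 : ∑ i, ∑ j, H i j * (k i * k j) = 2 * ∑ i, ∑ j, U i j * (k i * k j) := by
        rw [two_mul]
        nth_rw 2 [← h2]
        simp only [hH, Matrix.add_apply, Matrix.transpose_apply, add_mul, Finset.sum_add_distrib]
      simp only [e, hk]
      exact_mod_cast h3
    rw [this]
    set z := ∑ i, ∑ j, U i j * (k i * k j)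
    have hz : z ≤ z * z := by
      rcases le_or_gt z 0 with h0 | h0
      · nlinarith
      · nlinarith
    have : (z : ℝ) ≤ z * z := by exact_mod_cast hz
    nlinarith
  have tr1 : ∑ i, ∑ j, H i j * G i j = 8 := by
    have : ∀ i, ∑ j, H i j * G i j = 1 := fun i => by
      have := hGH i i
      rw [if_pos rfl] at this
      rw [← this]
      exact Finset.sum_congr rfl fun j _ => by rw [hHs i j, mul_comm]
    simp [this]
  have tr2 : ∑ i, ∑ j, ∑ k, ∑ l, H i j * H k l * (G i k * G j l) = 8 := by
    have : ∀ i, ∑ j, ∑ k, ∑ l, H i j * H k l * (G i k * G j l) = 1 := by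
      intro i
      calc _ = ∑ j, ∑ l, (H i j * G j l) * ∑ k, G i k * H k l := by
            refine Finset.sum_congr rfl fun j _ => ?_
            rw [Finset.sum_comm]
            refine Finset.sum_congr rfl fun l _ => ?_
            rw [Finset.mul_sum]
            exact Finset.sum_congr rfl fun k _ => by ring
        _ = ∑ j, H i j * G j i := by simp [hGH]
        _ = ∑ j, G i j * H j i := Finset.sum_congr rfl fun j _ => by
            rw [hHs i j, hGs j i, mul_comm]
        _ = 1 := by rw [hGH, if_pos rfl]
    simp [this]
  have tr3 : ∑ i, ∑ j, ∑ k, ∑ l, H i j * H k l * (G i l * G j k) = 8 := by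
    rw [← tr2]
    refine Finset.sum_congr rfl fun i _ => Finset.sum_congr rfl fun j _ => ?_
    rw [Finset.sum_comm]
    exact Finset.sum_congr rfl fun l _ => Finset.sum_congr rfl fun k _ => by rw [hHs k l]
  have s1 : ∑ x ∈ X, e x = 4032 := by
    have : ∑ x ∈ X, e x = ∑ i, ∑ j, (H i j : ℝ) * (144 * inner ℝ (g i) (g j)) := by
      rw [Finset.sum_comm]
      refine Finset.sum_congr rfl fun i _ => ?_
      rw [Finset.sum_comm]
      refine Finset.sum_congr rfl fun j _ => ?_
      rw [← h.sum_inner_mul_inner, Finset.mul_sum]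
    rw [this]
    have t : (∑ i, ∑ j, (H i j : ℝ) * (G i j : ℝ)) = 8 := by exact_mod_cast tr1
    calc _ = 504 * ∑ i, ∑ j, (H i j : ℝ) * (G i j : ℝ) := by
          simp only [Finset.mul_sum, hG]
          exact Finset.sum_congr rfl fun i _ => Finset.sum_congr rfl fun j _ => by ring
      _ = 4032 := by rw [t]; norm_num
  have s2 : ∑ x ∈ X, e x ^ 2 = 7840 := by
    have e2 : ∀ x, e x ^ 2 = ∑ i, ∑ j, ∑ k, ∑ l, ((H i j : ℝ) * H k l) *
        (inner ℝ x (g i) * inner ℝ x (g j) * (inner ℝ x (g k) * inner ℝ x (g l))) := by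
      intro x
      simp only [e, sq, Finset.sum_mul, Finset.mul_sum]
      refine Finset.sum_congr rfl fun i _ => Finset.sum_congr rfl fun j _ =>
        Finset.sum_congr rfl fun k _ => Finset.sum_congr rfl fun l _ => by ring
    have : ∑ x ∈ X, e x ^ 2 = ∑ i, ∑ j, ∑ k, ∑ l, ((H i j : ℝ) * H k l) *
        (8 * (inner ℝ (g i) (g j) * inner ℝ (g k) (g l) + inner ℝ (g i) (g k) * inner ℝ (g j) (g l)
          + inner ℝ (g i) (g l) * inner ℝ (g j) (g k))) := by
      simp only [e2]
      rw [Finset.sum_comm]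
      refine Finset.sum_congr rfl fun i _ => ?_
      rw [Finset.sum_comm]
      refine Finset.sum_congr rfl fun j _ => ?_
      rw [Finset.sum_comm]
      refine Finset.sum_congr rfl fun k _ => ?_
      rw [Finset.sum_comm]
      refine Finset.sum_congr rfl fun l _ => ?_
      rw [← h.sum_inner_mul_four, Finset.mul_sum]
    rw [this]
    have t1 : (∑ i, ∑ j, ∑ k, ∑ l, ((H i j : ℝ) * H k l) * ((G i j : ℝ) * G k l)) = 64 := by
      have t : (∑ i, ∑ j, (H i j : ℝ) * (G i j : ℝ)) = 8 := by exact_mod_cast tr1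
      rw [show (64 : ℝ) = 8 * 8 by norm_num]
      nth_rw 1 [← t]
      rw [← t]
      simp only [Finset.sum_mul, Finset.mul_sum]
      refine Finset.sum_congr rfl fun i _ => Finset.sum_congr rfl fun j _ =>
        Finset.sum_congr rfl fun k _ => Finset.sum_congr rfl fun l _ => by ring
    have t2 : (∑ i, ∑ j, ∑ k, ∑ l, ((H i j : ℝ) * H k l) * ((G i k : ℝ) * G j l)) = 8 := by
      exact_mod_cast tr2
    have t3 : (∑ i, ∑ j, ∑ k, ∑ l, ((H i j : ℝ) * H k l) * ((G i l : ℝ) * G j k)) = 8 := by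
      exact_mod_cast tr3
    calc _ = 98 * ((∑ i, ∑ j, ∑ k, ∑ l, ((H i j : ℝ) * H k l) * ((G i j : ℝ) * G k l))
          + (∑ i, ∑ j, ∑ k, ∑ l, ((H i j : ℝ) * H k l) * ((G i k : ℝ) * G j l))
          + (∑ i, ∑ j, ∑ k, ∑ l, ((H i j : ℝ) * H k l) * ((G i l : ℝ) * G j k))) := by
          simp only [← Finset.sum_add_distrib, Finset.mul_sum, hG]
          refine Finset.sum_congr rfl fun i _ => Finset.sum_congr rfl fun j _ =>
            Finset.sum_congr rfl fun k _ => Finset.sum_congr rfl fun l _ => by ring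
      _ = 7840 := by rw [t1, t2, t3]; norm_num
  have := Finset.sum_le_sum he
  rw [← Finset.mul_sum, s1, s2] at this
  norm_num at this

end DesignPair

/-! ### The configuration around a minimal vector -/

/-- The vectors around a fixed `α ∈ Y`: the seven `x i ∈ X` with `(x i, α) = 2`, and for `i ≠ j`
a vector `β i j ∈ Y` with inner product `2` with `x i`, `0` with `x j`, and `1` with the other
`x m`, chosen such that `β i j + β j i = α`. -/
structure Star {E : Type*} [NormedAddCommGroup E] [InnerProductSpace ℝ E] (X Y : Finset E)
    (α : E) (x : Fin 7 → E) (β : Fin 7 → Fin 7 → E) : Prop where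
  mem : α ∈ Y
  mem_left : ∀ i, x i ∈ X
  inner_self : ∀ i, inner ℝ (x i) (x i) = 1
  inner_ne : ∀ i j, i ≠ j → inner ℝ (x i) (x j) = 1 / 2
  sum_eq : ∑ i, x i = (2 : ℝ) • α
  beta_mem : ∀ i j, i ≠ j → β i j ∈ Y
  inner_beta : ∀ m i j, i ≠ j → inner ℝ (x m) (β i j) = if m = i then 2 else if m = j then 0 else 1
  beta_add : ∀ i j, i ≠ j → β i j + β j i = α

namespace DesignPair

variable {E : Type*} [NormedAddCommGroup E] [InnerProductSpace ℝ E]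
  {A B : AddSubgroup E} {X Y : Finset E}

theorem exists_enum_twos (h : DesignPair A B X Y 1 7) {α : E} (hα : α ∈ Y) :
    ∃ x : Fin 7 → E, (∀ z, z ∈ twos X α ↔ ∃ i, x i = z) ∧ (∀ i, inner ℝ (x i) (x i) = 1) ∧
      (∀ i j, i ≠ j → inner ℝ (x i) (x j) = 1 / 2) ∧ ∑ i, x i = (2 : ℝ) • α := by
  let e := (Finset.equivFinOfCardEq (h.card_twos hα)).symm
  have hm : ∀ i, (e i : E) ∈ twos X α := fun i => (e i).2
  refine ⟨fun i => e i, fun z => ⟨fun hz => ⟨e.symm ⟨z, hz⟩, by simp⟩, ?_⟩, fun i => ?_,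
    fun i j hij => ?_, ?_⟩
  · rintro ⟨i, rfl⟩; exact hm i
  · exact ((h.mem_left _).1 (mem_twos.1 (hm i)).1).2
  · refine h.inner_twos hα (hm i) (hm j) fun he => hij ?_
    exact e.injective (Subtype.ext he)
  · have := h.sum_twos hα
    rw [mul_one] at this
    rw [← this, ← Finset.sum_coe_sort (twos X α)]
    exact e.sum_comp fun z => (z : E)

/-- If `α' ≠ α` also has inner product `2` with `x i`, then its inner products with the other
`x m` are one `0` and five `1`: they are integers with sum `5`, and the norm of
`α' - 2 ∑ (x m, α') x m + (7 / 2) α` shows that the sum of their squares is at most `5`. -/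
theorem exists_inner_eq_zero (h : DesignPair A B X Y 1 7) {α α' : E} (hα : α ∈ Y)
    {x : Fin 7 → E} (hx : ∀ z, z ∈ twos X α ↔ ∃ i, x i = z)
    (hself : ∀ i, inner ℝ (x i) (x i) = 1) (hne : ∀ i j, i ≠ j → inner ℝ (x i) (x j) = 1 / 2)
    (hsum : ∑ i, x i = (2 : ℝ) • α) {i : Fin 7} (hα' : α' ∈ twos Y (x i)) (hαα' : α' ≠ α) :
    ∃ j, j ≠ i ∧ ∀ m, inner ℝ (x m) α' = if m = i then 2 else if m = j then 0 else 1 := by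
  have hxm : ∀ m, x m ∈ X ∧ inner ℝ (x m) α = 2 := fun m => mem_twos.1 ((hx _).2 ⟨m, rfl⟩)
  obtain ⟨hY, hi⟩ := mem_twos.1 hα'
  have hαα : inner ℝ α α = 7 := ((h.mem_right _).1 hα).2
  have hα'α' : inner ℝ α' α' = 7 := ((h.mem_right _).1 hY).2
  have hip : inner ℝ α α' = 7 / 2 := by
    refine h.symm.inner_twos (hxm i).1 ?_ hα' hαα'.symm
    rw [mem_twos, real_inner_comm]; exact ⟨hα, (hxm i).2⟩
  choose k hk _ _ using fun m => h.int_le_two (hxm m).1 hY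
  have hki : k i = 2 := by
    have : (k i : ℝ) = 2 := by rw [← hk, real_inner_comm, hi]
    exact_mod_cast this
  have s1 : ∑ m, k m = 7 := by
    have : (∑ m, (k m : ℝ)) = 7 := by
      simp only [← hk]
      rw [← sum_inner, hsum, inner_smul_left, hip]; norm_num
    exact_mod_cast this
  have s1' : (∑ m, (k m : ℝ)) = 7 := by exact_mod_cast s1
  have s2 : ∑ m, k m ^ 2 ≤ 9 := by
    set u := ∑ m, (k m : ℝ) • x m with hu
    have hul : ∀ v, inner ℝ u v = ∑ m, (k m : ℝ) * inner ℝ (x m) v := fun v => by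
      rw [hu, sum_inner]
      simp only [inner_smul_left, conj_trivial]
    have huα' : inner ℝ u α' = ∑ m, (k m : ℝ) ^ 2 := by
      rw [hul]
      exact Finset.sum_congr rfl fun m _ => by rw [hk]; ring
    have huα : inner ℝ u α = 14 := by
      rw [hul]
      simp only [(hxm _).2]
      rw [← Finset.sum_mul, s1']; norm_num
    have hxu : ∀ m, inner ℝ (x m) u = k m / 2 + 7 / 2 := by
      intro m
      rw [hu, inner_sum]
      have : ∀ n, inner ℝ (x m) ((k n : ℝ) • x n) =
          (if n = m then (k n : ℝ) / 2 else 0) + k n / 2 := fun n => by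
        rw [inner_smul_right]
        split_ifs with hmn
        · subst hmn; rw [hself]; ring
        · rw [hne _ _ (Ne.symm hmn)]; ring
      simp only [this, Finset.sum_add_distrib, Finset.sum_ite_eq', Finset.mem_univ, if_true]
      rw [← Finset.sum_div, s1']
    have huu : inner ℝ u u = (∑ m, (k m : ℝ) ^ 2) / 2 + 49 / 2 := by
      rw [hul]
      simp only [hxu, mul_add, Finset.sum_add_distrib]
      rw [← Finset.sum_mul, s1', Finset.sum_div]
      congr 1
      · exact Finset.sum_congr rfl fun m _ => by ring
      · norm_num
    have h0 : 0 ≤ inner ℝ (α' - (2 : ℝ) • u + (7 / 2 : ℝ) • α)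
        (α' - (2 : ℝ) • u + (7 / 2 : ℝ) • α) :=
      real_inner_self_nonneg
    simp only [inner_add_left, inner_sub_left, inner_add_right, inner_sub_right, inner_smul_left,
      inner_smul_right, conj_trivial] at h0
    rw [real_inner_comm α α', real_inner_comm u α', real_inner_comm u α, huu, huα, huα', hip, hαα,
      hα'α'] at h0
    have h1 : (∑ m, (k m : ℝ) ^ 2) < 10 := by linarith
    have h2 : ∑ m, k m ^ 2 < 10 := by exact_mod_cast h1
    linarith
  have hnn : ∀ m, 0 ≤ k m ^ 2 - k m := fun m => by
    rcases le_or_gt (k m) 0 with h0 | h0 <;> nlinarith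
  have h01 : ∀ m, m ≠ i → k m = 0 ∨ k m = 1 := by
    intro m hm
    have hle : k m ^ 2 - k m + (k i ^ 2 - k i) ≤ ∑ m, (k m ^ 2 - k m) :=
      Finset.add_le_sum (fun m _ => hnn m) (Finset.mem_univ _) (Finset.mem_univ _) hm
    rw [Finset.sum_sub_distrib, s1, hki] at hle
    have : k m * (k m - 1) = 0 := le_antisymm (by nlinarith) (by nlinarith [hnn m])
    rcases mul_eq_zero.1 this with h0 | h0
    · exact .inl h0
    · exact .inr (by linarith)
  have s3 : ∑ m ∈ Finset.univ.erase i, (1 - k m) = 1 := by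
    have := Finset.add_sum_erase Finset.univ (fun m => 1 - k m) (Finset.mem_univ i)
    simp only [hki, Finset.sum_sub_distrib (s := Finset.univ), s1] at this
    simp at this
    rw [Finset.sum_sub_distrib]
    simp
    linarith
  obtain ⟨j, hj, hj1⟩ : ∃ j ∈ Finset.univ.erase i, 1 - k j ≠ 0 := by
    apply Finset.exists_ne_zero_of_sum_ne_zero
    rw [s3]; exact one_ne_zero
  have hji : j ≠ i := (Finset.mem_erase.1 hj).1
  have hj0 : k j = 0 := (h01 j hji).resolve_right fun h1 => hj1 (by rw [h1, sub_self])
  refine ⟨j, hji, fun m => ?_⟩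
  rw [hk m]
  split_ifs with h1 h2
  · rw [h1, hki]; norm_num
  · rw [h2, hj0]; norm_num
  · rcases h01 m h1 with h3 | h3
    · exfalso
      have := Finset.add_le_sum (s := Finset.univ.erase i) (f := fun m => 1 - k m)
        (fun n hn => by rcases h01 n (Finset.mem_erase.1 hn).1 with h | h <;> simp [h])
        (Finset.mem_erase.2 ⟨h1, Finset.mem_univ _⟩) hj h2
      rw [s3, h3, hj0] at this
      norm_num at this
    · rw [h3]; norm_num

/-- Two vectors of `Y` other than `α` that have inner product `2` with the same `x i` and `0` with
the same `x j` coincide: `x i - x j` is another vector of `X` having inner product `2` with both. -/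
theorem eq_of_inner_eq_zero (h : DesignPair A B X Y 1 7) {x x' α' α'' : E} (hx : x ∈ X)
    (hx' : x' ∈ X) (hxx' : inner ℝ x x' = 1 / 2) (h1 : α' ∈ twos Y x) (h2 : α'' ∈ twos Y x)
    (h3 : inner ℝ x' α' = 0) (h4 : inner ℝ x' α'' = 0) : α' = α'' := by
  by_contra hne
  obtain ⟨hY1, hi1⟩ := mem_twos.1 h1
  obtain ⟨hY2, hi2⟩ := mem_twos.1 h2
  rw [real_inner_comm] at hi1 hi2
  obtain ⟨y, hy, hself, hyne, hsum⟩ := h.exists_enum_twos hY1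
  have hX := (h.mem_left x).1 hx
  have hX' := (h.mem_left x').1 hx'
  have hz : x - x' ∈ X := by
    refine (h.mem_left _).2 ⟨sub_mem hX.1 hX'.1, ?_⟩
    rw [real_inner_sub_sub_self, hX.2, hX'.2, hxx']; norm_num
  obtain ⟨i, hi⟩ := (hy x).1 (mem_twos.2 ⟨hx, hi1⟩)
  obtain ⟨j, hj⟩ := (hy (x - x')).1 (mem_twos.2 ⟨hz, by rw [inner_sub_left, hi1, h3]; norm_num⟩)
  have hij : j ≠ i := by
    rintro rfl
    have : x' = 0 := by
      rw [hi] at hj; simpa using hj.symm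
    rw [this] at hX'
    norm_num at hX'
  obtain ⟨m, -, hm⟩ := h.exists_inner_eq_zero hY1 hy hself hyne hsum (hi ▸ h2) (Ne.symm hne)
  have := hm j
  rw [hj, inner_sub_left, hi2, h4, if_neg hij] at this
  split_ifs at this <;> norm_num at this

/-- For each `i`, the other six vectors of `twos Y (x i)` correspond to the six `j ≠ i` by
`exists_inner_eq_zero` and `eq_of_inner_eq_zero`. -/
theorem exists_star (h : DesignPair A B X Y 1 7) : ∃ α x β, Star X Y α x β := by
  obtain ⟨α, hα⟩ := h.nonempty_right
  obtain ⟨x, hx, hself, hne, hsum⟩ := h.exists_enum_twos hα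
  have hxm : ∀ m, x m ∈ X ∧ inner ℝ (x m) α = 2 := fun m => mem_twos.1 ((hx _).2 ⟨m, rfl⟩)
  have hαα : inner ℝ α α = 7 := ((h.mem_right _).1 hα).2
  have hex : ∀ i j, i ≠ j → ∃ β ∈ Y, ∀ m, inner ℝ (x m) β =
      if m = i then 2 else if m = j then 0 else 1 := by
    classical
    intro i
    have hαi : α ∈ twos Y (x i) := by
      rw [mem_twos, real_inner_comm]; exact ⟨hα, (hxm i).2⟩
    have hc : ((twos Y (x i)).erase α).card = (Finset.univ.erase i).card := by
      rw [Finset.card_erase_of_mem hαi, h.symm.card_twos (hxm i).1]; simp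
    have hz : ∀ α' ∈ (twos Y (x i)).erase α, ∃ j, j ≠ i ∧
        ∀ m, inner ℝ (x m) α' = if m = i then 2 else if m = j then 0 else 1 := fun α' ha => by
      rw [Finset.mem_erase] at ha
      exact h.exists_inner_eq_zero hα hx hself hne hsum ha.2 ha.1
    choose! f hf hfm using hz
    have hs := Finset.surjOn_of_injOn_of_card_le (s := (twos Y (x i)).erase α)
      (t := Finset.univ.erase i) f (fun a ha => by simpa using hf a (Finset.mem_coe.1 ha))
      (fun a ha a' ha' he => by
        have ha := Finset.mem_coe.1 ha
        have ha' := Finset.mem_coe.1 ha'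
        refine h.eq_of_inner_eq_zero (hxm i).1 (hxm (f a)).1 (hne _ _ (hf a ha).symm)
          (Finset.mem_erase.1 ha).2 (Finset.mem_erase.1 ha').2 ?_ ?_
        · rw [hfm a ha, if_neg (hf a ha), if_pos rfl]
        · rw [he, hfm a' ha', if_neg (hf a' ha'), if_pos rfl]) hc.ge
    intro j hij
    obtain ⟨β, hβ, rfl⟩ := hs (show j ∈ _ by simpa using hij.symm)
    exact ⟨β, (mem_twos.1 (Finset.mem_erase.1 (Finset.mem_coe.1 hβ)).2).1, hfm β hβ⟩
  choose! β hβ hβx using hex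
  have hβα : ∀ i j, i ≠ j → inner ℝ α (β i j) = 7 / 2 := by
    intro i j hij
    have h2 : (2 : ℝ) * inner ℝ α (β i j) = 7 := by
      have : inner ℝ ((2 : ℝ) • α) (β i j) = 7 := by
        rw [← hsum, sum_inner]
        simp only [hβx i j hij]
        have : ∀ m, (if m = i then (2 : ℝ) else if m = j then 0 else 1) =
            1 + (if m = i then 1 else 0) - (if m = j then 1 else 0) := by
          intro m
          rcases eq_or_ne m i with rfl | h1
          · rw [if_pos rfl, if_pos rfl, if_neg hij]; norm_num
          · rw [if_neg h1, if_neg h1]; split_ifs <;> norm_num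
        simp only [this, Finset.sum_sub_distrib, Finset.sum_add_distrib]
        simp
      rwa [inner_smul_left, conj_trivial] at this
    linarith
  refine ⟨α, x, fun i j => if i < j then β i j else α - β j i, hα, fun i => (hxm i).1,
    hself, hne, hsum, ?_, ?_, ?_⟩
  · intro i j hij
    split_ifs with hlt
    · exact hβ i j hij
    · have hb := (h.mem_right _).1 (hβ j i hij.symm)
      refine (h.mem_right _).2 ⟨sub_mem ((h.mem_right _).1 hα).1 hb.1, ?_⟩
      rw [real_inner_sub_sub_self, hαα, hb.2, hβα j i hij.symm]; norm_num
  · intro m i j hij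
    by_cases hlt : i < j
    · simp only [if_pos hlt]; exact hβx i j hij m
    · simp only [if_neg hlt, inner_sub_right, (hxm m).2, hβx j i hij.symm m]
      rcases eq_or_ne m i with rfl | h1
      · simp [hij]
      · rcases eq_or_ne m j with rfl | h2
        · simp [hij.symm]
        · simp [h1, h2]; norm_num
  · intro i j hij
    rcases lt_or_gt_of_ne hij with hlt | hlt
    · rw [if_pos hlt, if_neg hlt.not_gt]; abel
    · rw [if_pos hlt, if_neg hlt.not_gt]; abel

end DesignPair

/-! ### Skew-symmetric systems of vectors -/

/-- A skew-symmetric system of vectors `b i j`, for `i, j < 7`, with the inner products that the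
components of the vectors `β i j` of a `Star` orthogonal to all `x m` have. -/
structure SkewSystem {E : Type*} [NormedAddCommGroup E] [InnerProductSpace ℝ E]
    (B : AddSubgroup E) (Y : Finset E) (α : E) (b : Fin 7 → Fin 7 → E) : Prop where
  skew : ∀ i j, b j i = -b i j
  inner_self : ∀ i j, i ≠ j → inner ℝ (b i j) (b i j) = 5 / 4
  inner_share : ∀ i j k, i ≠ j → i ≠ k → j ≠ k → inner ℝ (b i j) (b i k) = -1 / 4
  odd : ∀ i j k l, i ≠ j → i ≠ k → i ≠ l → j ≠ k → j ≠ l → k ≠ l →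
    ∃ z : ℤ, Odd z ∧ 4 * inner ℝ (b i j) (b k l) = (z : ℝ)
  mem : α ∈ Y
  mem_cycle : ∀ i j k, i ≠ j → i ≠ k → j ≠ k →
    (1 / 2 : ℝ) • α + (b i j + b j k + b k i) ∈ B
  inner_alpha : ∀ i j, inner ℝ (b i j) α = 0

section

variable {E : Type*} [NormedAddCommGroup E] [InnerProductSpace ℝ E]
  {A B : AddSubgroup E} {X Y : Finset E} {α : E} {x : Fin 7 → E} {β : Fin 7 → Fin 7 → E}

/-- The component of `β i j` orthogonal to all `x m`, and `0` for `i = j`. -/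
def orthPart (α : E) (x : Fin 7 → E) (β : Fin 7 → Fin 7 → E) (i j : Fin 7) : E :=
  if i = j then 0 else β i j - (1 / 2 : ℝ) • α - (2 : ℝ) • (x i - x j)

theorem orthPart_of_ne {i j : Fin 7} (hij : i ≠ j) :
    orthPart α x β i j = β i j - (1 / 2 : ℝ) • α - (2 : ℝ) • (x i - x j) := if_neg hij

theorem beta_eq {i j : Fin 7} (hij : i ≠ j) :
    β i j = orthPart α x β i j + ((1 / 2 : ℝ) • α + (2 : ℝ) • (x i - x j)) := by
  rw [orthPart_of_ne hij]; abel

namespace Star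

theorem inner_alpha (s : Star X Y α x β) (m : Fin 7) : inner ℝ (x m) α = 2 := by
  have h1 : inner ℝ (x m) ((2 : ℝ) • α) = 4 := by
    rw [← s.sum_eq, inner_sum]
    have : ∀ n, inner ℝ (x m) (x n) = (if n = m then (1 / 2 : ℝ) else 0) + 1 / 2 := fun n => by
      split_ifs with h
      · rw [h, s.inner_self]; norm_num
      · rw [s.inner_ne _ _ (Ne.symm h)]; norm_num
    simp only [this, Finset.sum_add_distrib]
    simp; norm_num
  rw [inner_smul_right] at h1
  linarith

theorem inner_alpha_self (s : Star X Y α x β) : inner ℝ α α = 7 := by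
  have h1 : inner ℝ ((2 : ℝ) • α) α = 14 := by
    rw [← s.sum_eq, sum_inner]
    simp only [s.inner_alpha]
    norm_num
  rw [inner_smul_left, conj_trivial] at h1
  linarith

theorem inner_orthPart (s : Star X Y α x β) (m i j : Fin 7) :
    inner ℝ (x m) (orthPart α x β i j) = 0 := by
  rcases eq_or_ne i j with rfl | hij
  · simp [orthPart]
  rw [orthPart_of_ne hij, inner_sub_right, inner_sub_right, inner_smul_right, inner_smul_right,
    inner_sub_right, s.inner_alpha, s.inner_beta m i j hij]
  rcases eq_or_ne m i with rfl | h1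
  · rw [if_pos rfl, s.inner_self, s.inner_ne _ _ hij]; norm_num
  rcases eq_or_ne m j with rfl | h2
  · rw [if_neg h1, if_pos rfl, s.inner_self, s.inner_ne _ _ h1]; norm_num
  rw [if_neg h1, if_neg h2, s.inner_ne _ _ h1, s.inner_ne _ _ h2]; norm_num

theorem alpha_inner_orthPart (s : Star X Y α x β) (i j : Fin 7) :
    inner ℝ (orthPart α x β i j) α = 0 := by
  have h1 : inner ℝ ((2 : ℝ) • α) (orthPart α x β i j) = 0 := by
    rw [← s.sum_eq, sum_inner]
    simp [s.inner_orthPart]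
  rw [inner_smul_left, conj_trivial] at h1
  rw [real_inner_comm]; linarith

theorem orthPart_inner (s : Star X Y α x β) (m i j : Fin 7) :
    inner ℝ (orthPart α x β i j) (x m) = 0 := by
  rw [real_inner_comm, s.inner_orthPart]

theorem inner_beta_beta (s : Star X Y α x β) {i j k l : Fin 7} (hij : i ≠ j) (hkl : k ≠ l) :
    inner ℝ (β i j) (β k l) = inner ℝ (orthPart α x β i j) (orthPart α x β k l) + 7 / 4 +
      4 * (inner ℝ (x i) (x k) - inner ℝ (x i) (x l) -
        inner ℝ (x j) (x k) + inner ℝ (x j) (x l)) := by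
  conv_lhs => rw [beta_eq (α := α) (x := x) (β := β) hij, beta_eq (α := α) (x := x) (β := β) hkl]
  have hc : ∀ m, inner ℝ α (x m) = 2 := fun m => by rw [real_inner_comm, s.inner_alpha]
  have hc' : ∀ i j, inner ℝ α (orthPart α x β i j) = 0 := fun i j => by
    rw [real_inner_comm, s.alpha_inner_orthPart]
  simp only [inner_add_left, inner_add_right, inner_sub_left, inner_sub_right, inner_smul_left,
    inner_smul_right, s.inner_orthPart, s.orthPart_inner, hc', s.alpha_inner_orthPart, hc,
    s.inner_alpha, s.inner_alpha_self, conj_trivial]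
  ring

theorem skewSystem (s : Star X Y α x β) (h : DesignPair A B X Y 1 7) :
    SkewSystem B Y α (orthPart α x β) where
  skew i j := by
    rcases eq_or_ne i j with rfl | hij
    · simp [orthPart]
    rw [orthPart_of_ne hij, orthPart_of_ne hij.symm, ← s.beta_add i j hij]
    module
  inner_self i j hij := by
    have h1 := ((h.mem_right _).1 (s.beta_mem i j hij)).2
    rw [s.inner_beta_beta hij hij, s.inner_self, s.inner_self, s.inner_ne i j hij,
      s.inner_ne j i hij.symm] at h1
    linarith
  inner_share i j k hij hik hjk := by
    have hne : β i j ≠ β i k := fun he => by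
      have h1 := s.inner_beta j i j hij
      rw [he, s.inner_beta j i k hik, if_neg hij.symm, if_neg hjk, if_neg hij.symm] at h1
      norm_num at h1
    have hm : ∀ n, i ≠ n → β i n ∈ DesignPair.twos Y (x i) := fun n hn => by
      rw [DesignPair.mem_twos, real_inner_comm, s.inner_beta i i n hn, if_pos rfl]
      exact ⟨s.beta_mem i n hn, rfl⟩
    have h1 := h.symm.inner_twos (s.mem_left i) (hm j hij) (hm k hik) hne
    rw [s.inner_beta_beta hij hik, s.inner_self, s.inner_ne _ _ hik, s.inner_ne _ _ hij.symm,
      s.inner_ne _ _ hjk] at h1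
    linarith
  odd i j k l hij hik hil hjk hjl hkl := by
    obtain ⟨z, hz⟩ := h.int_two_mul_inner ((h.mem_right _).1 (s.beta_mem i j hij)).1
      ((h.mem_right _).1 (s.beta_mem k l hkl)).1
    rw [s.inner_beta_beta hij hkl, s.inner_ne _ _ hik, s.inner_ne _ _ hil, s.inner_ne _ _ hjk,
      s.inner_ne _ _ hjl] at hz
    refine ⟨2 * z - 7, ⟨z - 4, by ring⟩, ?_⟩
    push_cast
    linarith
  mem := s.mem
  mem_cycle i j k hij hik hjk := by
    have : (1 / 2 : ℝ) • α + (orthPart α x β i j + orthPart α x β j k + orthPart α x β k i) =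
        β i j + β j k + β k i - α := by
      rw [orthPart_of_ne hij, orthPart_of_ne hjk, orthPart_of_ne hik.symm]
      module
    rw [this]
    have hB : ∀ i j, i ≠ j → β i j ∈ B := fun i j hij => ((h.mem_right _).1 (s.beta_mem i j hij)).1
    exact sub_mem (add_mem (add_mem (hB i j hij) (hB j k hjk)) (hB k i hik.symm))
      ((h.mem_right _).1 s.mem).1
  inner_alpha := s.alpha_inner_orthPart

end Star

end

/-! ### Triangles and total skew-symmetry -/

/-- The sum of `b` along the oriented triangle `i → j → k → i`. -/
def cyc {E : Type*} [AddCommGroup E] (b : Fin 7 → Fin 7 → E) (i j k : Fin 7) : E :=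
  b i j + b j k + b k i

/-- Four times the inner product of `b i j` and `b k l`. -/
def om {E : Type*} [NormedAddCommGroup E] [InnerProductSpace ℝ E] (b : Fin 7 → Fin 7 → E)
    (i j k l : Fin 7) : ℝ :=
  4 * inner ℝ (b i j) (b k l)

/-- Four times the inner product of `cyc b i j k` and `cyc b i l m`, expressed by `om b`; it is
skew-symmetric in all its indices. -/
def theta {E : Type*} [NormedAddCommGroup E] [InnerProductSpace ℝ E] (b : Fin 7 → Fin 7 → E)
    (i j k l m : Fin 7) : ℝ :=
  om b j k l m - om b i k l m + om b i j l m - om b i j k m + om b i j k l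

theorem nodup_four {i j k l : Fin 7} : [i, j, k, l].Nodup ↔
    i ≠ j ∧ i ≠ k ∧ i ≠ l ∧ j ≠ k ∧ j ≠ l ∧ k ≠ l := by
  simp; tauto

theorem nodup_five {i j k l m : Fin 7} : [i, j, k, l, m].Nodup ↔
    i ≠ j ∧ i ≠ k ∧ i ≠ l ∧ i ≠ m ∧ j ≠ k ∧ j ≠ l ∧ j ≠ m ∧ k ≠ l ∧ k ≠ m ∧ l ≠ m := by
  simp; tauto

namespace SkewSystem

variable {E : Type*} [NormedAddCommGroup E] [InnerProductSpace ℝ E]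
  {A B : AddSubgroup E} {X Y : Finset E} {α : E} {b : Fin 7 → Fin 7 → E}

theorem self_eq_zero (s : SkewSystem B Y α b) (i : Fin 7) : b i i = 0 := by
  have h := s.skew i i
  have h2 : (2 : ℝ) • b i i = 0 := by rw [two_smul]; nth_rw 2 [h]; rw [add_neg_cancel]
  exact (smul_eq_zero.1 h2).resolve_left two_ne_zero

theorem share_left (s : SkewSystem B Y α b) {i j k : Fin 7} (hij : i ≠ j) (hik : i ≠ k)
    (hjk : j ≠ k) : inner ℝ (b j i) (b i k) = 1 / 4 := by
  rw [s.skew i j, inner_neg_left, s.inner_share i j k hij hik hjk]; norm_num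

theorem share_right (s : SkewSystem B Y α b) {i j k : Fin 7} (hij : i ≠ j) (hik : i ≠ k)
    (hjk : j ≠ k) : inner ℝ (b i j) (b k i) = 1 / 4 := by
  rw [s.skew i k, inner_neg_right, s.inner_share i j k hij hik hjk]; norm_num

theorem share_both (s : SkewSystem B Y α b) {i j k : Fin 7} (hij : i ≠ j) (hik : i ≠ k)
    (hjk : j ≠ k) : inner ℝ (b j i) (b k i) = -1 / 4 := by
  rw [s.skew i k, inner_neg_right, s.share_left hij hik hjk]; norm_num

theorem sum_eq_zero (s : SkewSystem B Y α b) (i : Fin 7) : ∑ j, b i j = 0 := by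
  rw [← inner_self_eq_zero (𝕜 := ℝ), inner_sum]
  refine Finset.sum_eq_zero fun k _ => ?_
  rw [sum_inner]
  rcases eq_or_ne i k with rfl | hik
  · simp [s.self_eq_zero]
  have : ∀ j, inner ℝ (b i j) (b i k) =
      (if j = k then (3 / 2 : ℝ) else 0) + (if j = i then (1 / 4 : ℝ) else 0) - 1 / 4 := by
    intro j
    rcases eq_or_ne j k with rfl | hjk
    · rw [s.inner_self i j hik, if_pos rfl, if_neg hik.symm]; norm_num
    rcases eq_or_ne j i with rfl | hji
    · rw [s.self_eq_zero, if_pos rfl, if_neg hjk]; simp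
    rw [s.inner_share i j k hji.symm hik hjk, if_neg hjk, if_neg hji]; norm_num
  simp only [this, Finset.sum_sub_distrib, Finset.sum_add_distrib]
  simp
  norm_num

theorem om_swap_left (s : SkewSystem B Y α b) (i j k l : Fin 7) :
    om b j i k l = -om b i j k l := by
  rw [om, s.skew i j, inner_neg_left, om]; ring

theorem om_swap_right (s : SkewSystem B Y α b) (i j k l : Fin 7) :
    om b i j l k = -om b i j k l := by
  rw [om, s.skew k l, inner_neg_right, om]; ring

theorem om_symm (b : Fin 7 → Fin 7 → E) (i j k l : Fin 7) : om b k l i j = om b i j k l := by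
  rw [om, real_inner_comm, om]

theorem om_odd (s : SkewSystem B Y α b) {i j k l : Fin 7} (h : [i, j, k, l].Nodup) :
    ∃ z : ℤ, Odd z ∧ om b i j k l = (z : ℝ) := by
  obtain ⟨h1, h2, h3, h4, h5, h6⟩ := nodup_four.1 h
  exact s.odd i j k l h1 h2 h3 h4 h5 h6

theorem om_le (s : SkewSystem B Y α b) {i j k l : Fin 7} (hij : i ≠ j) (hkl : k ≠ l) :
    om b i j k l ≤ 5 := by
  have h1 := real_inner_mul_inner_self_le (b i j) (b k l)
  rw [s.inner_self i j hij, s.inner_self k l hkl] at h1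
  rw [om]
  nlinarith

theorem sum_om_eq_zero (s : SkewSystem B Y α b) (i j k : Fin 7) : ∑ l, om b i j k l = 0 := by
  simp only [om]
  rw [← Finset.mul_sum, ← inner_sum, s.sum_eq_zero, inner_zero_right, mul_zero]

theorem om_share (s : SkewSystem B Y α b) {i j k : Fin 7} (hij : i ≠ j) (hik : i ≠ k)
    (hjk : j ≠ k) : om b i j k i = 1 ∧ om b i j k j = -1 ∧ om b i j k k = 0 := by
  refine ⟨?_, ?_, ?_⟩
  · rw [om, s.share_right hij hik hjk]; norm_num
  · rw [om, s.share_both hij.symm hjk hik]; norm_num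
  · rw [om, s.self_eq_zero, inner_zero_right, mul_zero]

theorem cyc_swap (s : SkewSystem B Y α b) (i j k : Fin 7) : cyc b i k j = -cyc b i j k := by
  simp only [cyc]
  rw [s.skew k i, s.skew j k, s.skew i j]; abel

theorem cyc_rotate {E : Type*} [AddCommGroup E] (b : Fin 7 → Fin 7 → E) (i j k : Fin 7) :
    cyc b j k i = cyc b i j k := by
  simp only [cyc]; abel

theorem inner_cyc_self (s : SkewSystem B Y α b) {i j k : Fin 7} (hij : i ≠ j) (hik : i ≠ k)
    (hjk : j ≠ k) : inner ℝ (cyc b i j k) (cyc b i j k) = 21 / 4 := by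
  simp only [cyc, inner_add_left, inner_add_right, s.inner_self i j hij, s.inner_self j k hjk,
    s.inner_self k i hik.symm, s.share_left hij.symm hjk hik, s.share_right hij hik hjk,
    s.share_left hjk.symm hik.symm hij.symm, s.share_right hjk hij.symm hik.symm,
    s.share_left hik hij hjk.symm, s.share_right hik.symm hjk.symm hij]
  norm_num

theorem inner_alpha_self (s : SkewSystem B Y α b) (h : DesignPair A B X Y 1 7) :
    inner ℝ α α = 7 :=
  ((h.mem_right _).1 s.mem).2

theorem inner_cyc_alpha (s : SkewSystem B Y α b) (i j k : Fin 7) :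
    inner ℝ (cyc b i j k) α = 0 := by
  simp [cyc, inner_add_left, s.inner_alpha]

theorem inner_cyc_add (s : SkewSystem B Y α b) (h : DesignPair A B X Y 1 7)
    (i j k i' j' k' : Fin 7) :
    inner ℝ ((1 / 2 : ℝ) • α + cyc b i j k) ((1 / 2 : ℝ) • α + cyc b i' j' k') =
      7 / 4 + inner ℝ (cyc b i j k) (cyc b i' j' k') := by
  have h1 : inner ℝ α (cyc b i' j' k') = 0 := by rw [real_inner_comm, s.inner_cyc_alpha]
  simp only [inner_add_left, inner_add_right, inner_smul_left, inner_smul_right, h1,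
    s.inner_cyc_alpha, s.inner_alpha_self h, conj_trivial]
  norm_num

theorem cyc_mem (s : SkewSystem B Y α b) (h : DesignPair A B X Y 1 7) {i j k : Fin 7}
    (hij : i ≠ j) (hik : i ≠ k) (hjk : j ≠ k) : (1 / 2 : ℝ) • α + cyc b i j k ∈ Y := by
  refine (h.mem_right _).2 ⟨s.mem_cycle i j k hij hik hjk, ?_⟩
  rw [s.inner_cyc_add h, s.inner_cyc_self hij hik hjk]; norm_num

/-- The vectors `α / 2 + cyc b i j k` belong to `Y`, so the inner product of distinct ones is at
most half their norm. -/
theorem inner_cyc_le (s : SkewSystem B Y α b) (h : DesignPair A B X Y 1 7)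
    {i j k i' j' k' : Fin 7} (hij : i ≠ j) (hik : i ≠ k) (hjk : j ≠ k) (hij' : i' ≠ j')
    (hik' : i' ≠ k') (hjk' : j' ≠ k') (hne : cyc b i j k ≠ cyc b i' j' k') :
    inner ℝ (cyc b i j k) (cyc b i' j' k') ≤ 7 / 4 := by
  have := h.inner_le_right (s.cyc_mem h hij hik hjk) (s.cyc_mem h hij' hik' hjk')
    fun he => hne (add_left_cancel he)
  rw [s.inner_cyc_add h] at this
  linarith

theorem four_mul_inner_cyc_share (s : SkewSystem B Y α b) {i j k l : Fin 7}
    (h : [i, j, k, l].Nodup) : 4 * inner ℝ (cyc b i j k) (cyc b i j l) =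
      7 + om b i k l j - om b i l j k := by
  obtain ⟨hij, hik, hil, hjk, hjl, hkl⟩ := nodup_four.1 h
  have e1 : inner ℝ (b j k) (b l i) = -(om b i l j k) / 4 := by
    rw [s.skew i l, inner_neg_right, real_inner_comm, om]; ring
  have e2 : inner ℝ (b k i) (b j l) = om b i k l j / 4 := by
    rw [s.skew i k, s.skew l j, inner_neg_neg, om]; ring
  simp only [cyc, inner_add_left, inner_add_right, s.inner_self i j hij,
    s.share_left hij.symm hjl hil, s.share_right hij hil hjl,
    s.share_right hjk hij.symm hik.symm, s.inner_share j k l hjk hjl hkl, e1,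
    s.share_left hik hij hjk.symm, e2, s.share_both hik hil hkl]
  ring

/-- On distinct indices `om b` is totally skew-symmetric: the bound on the inner product of
`cyc b i j k` and `cyc b i j l` says that a cyclic shift of three indices does not decrease it. -/
theorem om_swap_mid (s : SkewSystem B Y α b) (hp : DesignPair A B X Y 1 7) {i j k l : Fin 7}
    (h : [i, j, k, l].Nodup) : om b i k j l = -om b i j k l := by
  have key : ∀ j k l, [i, j, k, l].Nodup → om b i k l j ≤ om b i l j k := by
    intro j k l h
    obtain ⟨hij, hik, hil, hjk, hjl, hkl⟩ := nodup_four.1 h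
    have h1 := s.four_mul_inner_cyc_share h
    have h2 := s.om_le hik hjl.symm
    have h3 : -5 ≤ om b i l j k := by
      have := s.om_le hil.symm hjk
      rw [s.om_swap_left i l] at this; linarith
    have hne : cyc b i j k ≠ cyc b i j l := fun he => by
      rw [← he, s.inner_cyc_self hij hik hjk] at h1
      have h4 := s.om_le hil.symm hjk
      rw [s.om_swap_left i l] at h4
      obtain ⟨z, hz, hz'⟩ := s.om_odd h
      linarith
    have := s.inner_cyc_le hp hij hik hjk hij hil hjl hne
    linarith
  obtain ⟨hij, hik, hil, hjk, hjl, hkl⟩ := nodup_four.1 h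
  have h1 := key j k l h
  have h2 := key k l j (nodup_four.2 ⟨hik, hil, hij, hkl, hjk.symm, hjl.symm⟩)
  have h3 := key l j k (nodup_four.2 ⟨hil, hij, hik, hjl.symm, hkl.symm, hjk⟩)
  rw [s.om_swap_right i k l j]
  linarith

theorem om_cycle (s : SkewSystem B Y α b) (hp : DesignPair A B X Y 1 7) {i j k l : Fin 7}
    (h : [i, j, k, l].Nodup) : om b j k i l = om b i j k l := by
  obtain ⟨hij, hik, hil, hjk, hjl, hkl⟩ := nodup_four.1 h
  rw [om_symm, s.om_swap_mid hp (nodup_four.2 ⟨hij, hil, hik, hjl, hjk, hkl.symm⟩),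
    s.om_swap_right, neg_neg]

theorem inner_cyc_share (s : SkewSystem B Y α b) (hp : DesignPair A B X Y 1 7) {i j k l : Fin 7}
    (h : [i, j, k, l].Nodup) : inner ℝ (cyc b i j k) (cyc b i j l) = 7 / 4 := by
  obtain ⟨hij, hik, hil, hjk, hjl, hkl⟩ := nodup_four.1 h
  have h1 := s.four_mul_inner_cyc_share h
  have h2 := s.om_swap_mid hp (nodup_four.2 ⟨hil, hik, hij, hkl.symm, hjl.symm, hjk.symm⟩)
  rw [s.om_swap_right i l j k] at h2
  linarith

theorem four_mul_inner_cyc (s : SkewSystem B Y α b) (hp : DesignPair A B X Y 1 7)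
    {i j k l m : Fin 7} (h : [i, j, k, l, m].Nodup) :
    4 * inner ℝ (cyc b i j k) (cyc b i l m) = theta b i j k l m := by
  obtain ⟨hij, hik, hil, him, hjk, hjl, hjm, hkl, hkm, hlm⟩ := nodup_five.1 h
  have e1 : inner ℝ (b j k) (b i l) = om b i j k l / 4 := by
    rw [← s.om_cycle hp (nodup_four.2 ⟨hij, hik, hil, hjk, hjl, hkl⟩), om]; ring
  have e2 : inner ℝ (b j k) (b m i) = -om b i j k m / 4 := by
    rw [← s.om_cycle hp (nodup_four.2 ⟨hij, hik, him, hjk, hjm, hkm⟩), s.skew i m,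
      inner_neg_right, om]; ring
  have e3 : inner ℝ (b k i) (b l m) = -om b i k l m / 4 := by
    rw [s.skew i k, inner_neg_left, om]; ring
  simp only [cyc, inner_add_left, inner_add_right, s.inner_share i j l hij hil hjl, e1, e2, e3,
    s.share_right hij him hjm, s.share_left hik hil hkl, s.share_both hik him hkm]
  rw [theta]
  simp only [om]
  ring

theorem theta_le (s : SkewSystem B Y α b) (hp : DesignPair A B X Y 1 7)
    {i j k l m : Fin 7} (h : [i, j, k, l, m].Nodup) : theta b i j k l m ≤ 7 := by
  obtain ⟨hij, hik, hil, him, hjk, hjl, hjm, hkl, hkm, hlm⟩ := nodup_five.1 h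
  rw [← s.four_mul_inner_cyc hp h]
  have hne : cyc b i j k ≠ cyc b i l m := fun he => by
    have h1 := s.inner_cyc_share hp (nodup_four.2 ⟨hij, hik, hil, hjk, hjl, hkl⟩)
    have h2 := s.inner_cyc_share hp (nodup_four.2 ⟨hil, him, hij, hlm, hjl.symm, hjm.symm⟩)
    rw [he, s.cyc_swap i l j, inner_neg_right] at h1
    linarith
  linarith [s.inner_cyc_le hp hij hik hjk hil him hlm hne]

theorem abs_theta_le (s : SkewSystem B Y α b) (hp : DesignPair A B X Y 1 7)
    {i j k l m : Fin 7} (h : [i, j, k, l, m].Nodup) : |theta b i j k l m| ≤ 7 := by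
  obtain ⟨hij, hik, hil, him, hjk, hjl, hjm, hkl, hkm, hlm⟩ := nodup_five.1 h
  have h' : [i, j, k, m, l].Nodup :=
    nodup_five.2 ⟨hij, hik, him, hil, hjk, hjm, hjl, hkm, hkl, hlm.symm⟩
  have h1 := s.theta_le hp h'
  rw [← s.four_mul_inner_cyc hp h', s.cyc_swap i l m, inner_neg_right, mul_neg,
    s.four_mul_inner_cyc hp h] at h1
  exact abs_le.2 ⟨by linarith, s.theta_le hp h⟩

end SkewSystem

/-! ### The trace inequality -/

/-- For vectors `v i` in a Euclidean space `F`, the symmetric operator `∑ (v i, ·) v i` has trace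
`∑ (v i, v i)`, and the trace of its square is `∑ (v i, v j) ^ 2`. -/
theorem sq_sum_inner_self_le {F ι : Type*} [NormedAddCommGroup F] [InnerProductSpace ℝ F]
    [FiniteDimensional ℝ F] [Fintype ι] (v : ι → F) :
    (∑ i, inner ℝ (v i) (v i)) ^ 2 ≤
      Module.finrank ℝ F * ∑ i, ∑ j, inner ℝ (v i) (v j) ^ 2 := by
  let e := stdOrthonormalBasis ℝ F
  have hv : ∀ i j, inner ℝ (v i) (v j) = ∑ s, inner ℝ (v i) (e s) * inner ℝ (v j) (e s) := by
    intro i j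
    rw [← e.sum_inner_mul_inner]
    exact Finset.sum_congr rfl fun s _ => by rw [real_inner_comm (e s) (v j)]
  let T : Fin (Module.finrank ℝ F) → Fin (Module.finrank ℝ F) → ℝ := fun s t =>
    ∑ i, inner ℝ (v i) (e s) * inner ℝ (v i) (e t)
  have h1 : ∑ i, inner ℝ (v i) (v i) = ∑ s, T s s := by
    simp only [hv, T]; exact Finset.sum_comm
  have h2 : ∑ i, ∑ j, inner ℝ (v i) (v j) ^ 2 = ∑ s, ∑ t, T s t ^ 2 := by
    have l : ∀ i j, inner ℝ (v i) (v j) ^ 2 = ∑ s, ∑ t,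
        inner ℝ (v i) (e s) * inner ℝ (v j) (e s) * (inner ℝ (v i) (e t) * inner ℝ (v j) (e t)) :=
      fun i j => by rw [hv, sq, Finset.sum_mul_sum]
    have r : ∀ s t, T s t ^ 2 = ∑ i, ∑ j,
        inner ℝ (v i) (e s) * inner ℝ (v j) (e s) * (inner ℝ (v i) (e t) * inner ℝ (v j) (e t)) :=
      fun s t => by
        rw [sq, Finset.sum_mul_sum]
        exact Finset.sum_congr rfl fun i _ => Finset.sum_congr rfl fun j _ => by ring
    simp only [l, r]
    calc _ = ∑ i, ∑ s, ∑ j, ∑ t, inner ℝ (v i) (e s) * inner ℝ (v j) (e s) *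
          (inner ℝ (v i) (e t) * inner ℝ (v j) (e t)) :=
          Finset.sum_congr rfl fun i _ => Finset.sum_comm
      _ = ∑ s, ∑ i, ∑ j, ∑ t, inner ℝ (v i) (e s) * inner ℝ (v j) (e s) *
          (inner ℝ (v i) (e t) * inner ℝ (v j) (e t)) := Finset.sum_comm
      _ = ∑ s, ∑ i, ∑ t, ∑ j, inner ℝ (v i) (e s) * inner ℝ (v j) (e s) *
          (inner ℝ (v i) (e t) * inner ℝ (v j) (e t)) :=
          Finset.sum_congr rfl fun s _ => Finset.sum_congr rfl fun i _ => Finset.sum_comm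
      _ = _ := Finset.sum_congr rfl fun s _ => Finset.sum_comm
  rw [h1, h2]
  calc (∑ s, T s s) ^ 2 ≤ Module.finrank ℝ F * ∑ s, T s s ^ 2 := by
        simpa using sq_sum_le_card_mul_sum_sq (s := Finset.univ) (f := fun s => T s s)
    _ ≤ _ := by
        gcongr with s
        exact Finset.single_le_sum (f := fun t => T s t ^ 2) (fun t _ => sq_nonneg _)
          (Finset.mem_univ s)

namespace Star

variable {E : Type*} [NormedAddCommGroup E] [InnerProductSpace ℝ E]
  {X Y : Finset E} {α : E} {x : Fin 7 → E} {β : Fin 7 → Fin 7 → E}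

theorem linearIndependent (s : Star X Y α x β) : LinearIndependent ℝ x := by
  rw [Fintype.linearIndependent_iff]
  intro g hg i
  have h1 : ∀ m, inner ℝ (x m) (∑ n, g n • x n) = g m / 2 + (∑ n, g n) / 2 := by
    intro m
    rw [inner_sum]
    have : ∀ n, inner ℝ (x m) (g n • x n) = (if n = m then g n / 2 else 0) + g n / 2 := fun n => by
      rw [inner_smul_right]
      split_ifs with h
      · rw [h, s.inner_self]; ring
      · rw [s.inner_ne _ _ (Ne.symm h)]; ring
    simp only [this, Finset.sum_add_distrib, ← Finset.sum_div]
    simp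
  simp only [hg, inner_zero_right] at h1
  have h2 : ∀ m, g m = -∑ n, g n := fun m => by linarith [h1 m]
  have h3 : ∑ n, g n = -(7 * ∑ n, g n) := by
    conv_lhs => rw [Finset.sum_congr rfl fun m _ => h2 m]
    simp
  rw [h2]; linarith

/-- The seven `x m` are linearly independent, so the vectors `orthPart α x β i j` lie in a space of
dimension `9`. -/
theorem sq_sum_inner_orthPart_le [FiniteDimensional ℝ E] (hE : Module.finrank ℝ E = 16)
    (s : Star X Y α x β) {ι : Type*} [Fintype ι] (p : ι → Fin 7 × Fin 7) (c : ι → ℝ) :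
    (∑ i, inner ℝ (c i • orthPart α x β (p i).1 (p i).2) (c i • orthPart α x β (p i).1 (p i).2)) ^ 2
      ≤ 9 * ∑ i, ∑ j, inner ℝ (c i • orthPart α x β (p i).1 (p i).2)
        (c j • orthPart α x β (p j).1 (p j).2) ^ 2 := by
  let W := Submodule.span ℝ (Set.range x)
  have hW : Module.finrank ℝ W = 7 := by
    simpa using finrank_span_eq_card s.linearIndependent
  have hW' : Module.finrank ℝ Wᗮ = 9 := by
    have := W.finrank_add_finrank_orthogonal
    omega
  have hm : ∀ i, c i • orthPart α x β (p i).1 (p i).2 ∈ Wᗮ := fun i => by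
    refine Submodule.smul_mem _ _ ?_
    rw [Submodule.mem_orthogonal]
    intro w hw
    induction hw using Submodule.span_induction with
    | mem w hw => obtain ⟨m, rfl⟩ := hw; exact s.inner_orthPart _ _ _
    | zero => simp
    | add u v _ _ hu hv => rw [inner_add_left, hu, hv, add_zero]
    | smul a u _ hu => rw [inner_smul_left, hu, mul_zero]
  have := sq_sum_inner_self_le fun i => (⟨_, hm i⟩ : Wᗮ)
  rw [hW'] at this
  exact_mod_cast this

end Star

/-! ### Skew matrices of order seven -/

/-- The condition on the numbers `a, …, g` of elements of the seven classes of `ZMod 7` that the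
row sums of `h` in `abs_eq_seven` vanish: each nonempty class is in balance with the others. -/
abbrev CountsBalanced (a b c d e f g : ℕ) : Prop :=
  (a = 0 ∨ b + 3 * d + 5 * f = 5 * c + 3 * e + g) ∧
  (b = 0 ∨ c + 3 * e + 5 * g = 5 * d + 3 * f + a) ∧
  (c = 0 ∨ d + 3 * f + 5 * a = 5 * e + 3 * g + b) ∧
  (d = 0 ∨ e + 3 * g + 5 * b = 5 * f + 3 * a + c) ∧
  (e = 0 ∨ f + 3 * a + 5 * c = 5 * g + 3 * b + d) ∧
  (f = 0 ∨ g + 3 * b + 5 * d = 5 * a + 3 * c + e) ∧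
  (g = 0 ∨ a + 3 * c + 5 * e = 5 * b + 3 * d + f)

/-- Balanced class counts with a large sum of squares of the entries of `h` are concentrated in
one class. -/
def CountsConcentrated (a b c d e f g : ℕ) : Prop :=
  (CountsBalanced a b c d e f g ∧
    1491 ≤ 49 * (a * a + b * b + c * c + d * d + e * e + f * f + g * g) +
      2 * (a * b + b * c + c * d + d * e + e * f + f * g + g * a) +
      50 * (a * c + b * d + c * e + d * f + e * g + f * a + g * b) +
      18 * (a * d + b * e + c * f + d * g + e * a + f * b + g * c)) →
    a = 7 ∨ b = 7 ∨ c = 7 ∨ d = 7 ∨ e = 7 ∨ f = 7 ∨ g = 7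

instance (a b c d e f g : ℕ) : Decidable (CountsConcentrated a b c d e f g) := by
  unfold CountsConcentrated; infer_instance

theorem countsConcentrated : ∀ a < 8, ∀ b < 8 - a, ∀ c < 8 - (a + b), ∀ d < 8 - (a + b + c),
    ∀ e < 8 - (a + b + c + d), ∀ f < 8 - (a + b + c + d + e),
    CountsConcentrated a b c d e f (7 - (a + b + c + d + e + f)) := by
  decide +kernel

/-- The odd integer of absolute value less than `7` in a nonzero class modulo `7`, and `0` for the
zero class. -/
def oddRep : ZMod 7 → ℤ := ![0, 1, -5, 3, -3, 5, -1]

/-- The largest square of an odd integer of absolute value at most `7` in a class modulo `7`. -/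
def oddRepSq : ZMod 7 → ℤ := ![49, 1, 25, 9, 9, 25, 1]

theorem eq_oddRep {n : ℤ} (h : |n| ≤ 7) (ho : Odd n) (h7 : (n : ZMod 7) ≠ 0) :
    n = oddRep n := by
  obtain ⟨h1, h2⟩ := abs_le.1 h
  interval_cases n <;> first | rfl | exact absurd ho (by decide) | exact absurd rfl h7

theorem sq_le_oddRepSq {n : ℤ} (h : |n| ≤ 7) (ho : Odd n) : n ^ 2 ≤ oddRepSq n := by
  obtain ⟨h1, h2⟩ := abs_le.1 h
  interval_cases n <;> first | exact absurd ho (by decide) | decide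

theorem sum_comp_eq {α : Type*} [Fintype α] (f : α → ZMod 7) (g : ZMod 7 → ℤ) :
    ∑ a, g (f a) = ∑ d, ((Finset.univ.filter fun a => f a = d).card : ℤ) * g d := by
  have : ∀ a, g (f a) = ∑ d, if f a = d then g d else 0 := fun a => by simp
  simp only [this]
  rw [Finset.sum_comm]
  refine Finset.sum_congr rfl fun d _ => ?_
  rw [← Finset.sum_filter, Finset.sum_const, nsmul_eq_mul]

/-- The class counts of `abs_eq_seven`, with `oddRep` and `oddRepSq` written out, satisfy the
hypotheses of `countsConcentrated`. -/
theorem exists_eq_seven {m : ZMod 7 → ℕ}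
    (hbal : ∀ c, m c = 0 ∨ ∑ d, (m d : ℤ) * oddRep (d - c) = 0) (htot : ∑ d, m d = 7)
    (hsq : 1491 ≤ ∑ c, ∑ d, (m c : ℤ) * (m d * oddRepSq (d - c))) : ∃ c, m c = 7 := by
  have e : ∀ g : ZMod 7 → ℤ, ∑ d, g d = g 0 + g 1 + g 2 + g 3 + g 4 + g 5 + g 6 := fun g =>
    Fin.sum_univ_seven g
  rw [show ∑ d, m d = m 0 + m 1 + m 2 + m 3 + m 4 + m 5 + m 6 from Fin.sum_univ_seven m] at htot
  have p0 : ∑ d, (m d : ℤ) * oddRep (d - 0) =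
      m 0 * 0 + m 1 * 1 + m 2 * (-5) + m 3 * 3 + m 4 * (-3) + m 5 * 5 + m 6 * (-1) := e _
  have p1 : ∑ d, (m d : ℤ) * oddRep (d - 1) =
      m 0 * (-1) + m 1 * 0 + m 2 * 1 + m 3 * (-5) + m 4 * 3 + m 5 * (-3) + m 6 * 5 := e _
  have p2 : ∑ d, (m d : ℤ) * oddRep (d - 2) =
      m 0 * 5 + m 1 * (-1) + m 2 * 0 + m 3 * 1 + m 4 * (-5) + m 5 * 3 + m 6 * (-3) := e _
  have p3 : ∑ d, (m d : ℤ) * oddRep (d - 3) =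
      m 0 * (-3) + m 1 * 5 + m 2 * (-1) + m 3 * 0 + m 4 * 1 + m 5 * (-5) + m 6 * 3 := e _
  have p4 : ∑ d, (m d : ℤ) * oddRep (d - 4) =
      m 0 * 3 + m 1 * (-3) + m 2 * 5 + m 3 * (-1) + m 4 * 0 + m 5 * 1 + m 6 * (-5) := e _
  have p5 : ∑ d, (m d : ℤ) * oddRep (d - 5) =
      m 0 * (-5) + m 1 * 3 + m 2 * (-3) + m 3 * 5 + m 4 * (-1) + m 5 * 0 + m 6 * 1 := e _
  have p6 : ∑ d, (m d : ℤ) * oddRep (d - 6) =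
      m 0 * 1 + m 1 * (-5) + m 2 * 3 + m 3 * (-3) + m 4 * 5 + m 5 * (-1) + m 6 * 0 := e _
  have q0 : ∑ d, (m d : ℤ) * oddRepSq (d - 0) =
      m 0 * 49 + m 1 * 1 + m 2 * 25 + m 3 * 9 + m 4 * 9 + m 5 * 25 + m 6 * 1 := e _
  have q1 : ∑ d, (m d : ℤ) * oddRepSq (d - 1) =
      m 0 * 1 + m 1 * 49 + m 2 * 1 + m 3 * 25 + m 4 * 9 + m 5 * 9 + m 6 * 25 := e _
  have q2 : ∑ d, (m d : ℤ) * oddRepSq (d - 2) =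
      m 0 * 25 + m 1 * 1 + m 2 * 49 + m 3 * 1 + m 4 * 25 + m 5 * 9 + m 6 * 9 := e _
  have q3 : ∑ d, (m d : ℤ) * oddRepSq (d - 3) =
      m 0 * 9 + m 1 * 25 + m 2 * 1 + m 3 * 49 + m 4 * 1 + m 5 * 25 + m 6 * 9 := e _
  have q4 : ∑ d, (m d : ℤ) * oddRepSq (d - 4) =
      m 0 * 9 + m 1 * 9 + m 2 * 25 + m 3 * 1 + m 4 * 49 + m 5 * 1 + m 6 * 25 := e _
  have q5 : ∑ d, (m d : ℤ) * oddRepSq (d - 5) =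
      m 0 * 25 + m 1 * 9 + m 2 * 9 + m 3 * 25 + m 4 * 1 + m 5 * 49 + m 6 * 1 := e _
  have q6 : ∑ d, (m d : ℤ) * oddRepSq (d - 6) =
      m 0 * 1 + m 1 * 25 + m 2 * 9 + m 3 * 9 + m 4 * 25 + m 5 * 1 + m 6 * 49 := e _
  have b0 := hbal 0
  rw [p0] at b0
  have b1 := hbal 1
  rw [p1] at b1
  have b2 := hbal 2
  rw [p2] at b2
  have b3 := hbal 3
  rw [p3] at b3
  have b4 := hbal 4
  rw [p4] at b4
  have b5 := hbal 5
  rw [p5] at b5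
  have b6 := hbal 6
  rw [p6] at b6
  simp only [← Finset.mul_sum] at hsq
  rw [e, q0, q1, q2, q3, q4, q5, q6] at hsq
  clear p0 p1 p2 p3 p4 p5 p6 q0 q1 q2 q3 q4 q5 q6 hbal e
  have key := countsConcentrated (m 0) (by omega) (m 1) (by omega) (m 2) (by omega) (m 3)
    (by omega) (m 4) (by omega) (m 5) (by omega)
  rw [show 7 - (m 0 + m 1 + m 2 + m 3 + m 4 + m 5) = m 6 by omega, CountsConcentrated] at key
  rcases key
    (And.intro ⟨b0.imp_right fun h => by zify; linarith, b1.imp_right fun h => by zify; linarith,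
    b2.imp_right fun h => by zify; linarith, b3.imp_right fun h => by zify; linarith,
    b4.imp_right fun h => by zify; linarith, b5.imp_right fun h => by zify; linarith,
    b6.imp_right fun h => by zify; linarith⟩ (by zify; linarith)) with
    h | h | h | h | h | h | h
  exacts [⟨_, h⟩, ⟨_, h⟩, ⟨_, h⟩, ⟨_, h⟩, ⟨_, h⟩, ⟨_, h⟩, ⟨_, h⟩]

/-- A skew-symmetric matrix of order `7` with zero row sums, whose entries off the diagonal are odd,
bounded by `7` and modulo `7` differences `f b - f a`, and not too small, has only the entries `±7`
there. Indeed, the entries are `±7` or determined by the class of `f b - f a`, and this leaves few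
possibilities for the sizes of the classes of `f`. -/
theorem abs_eq_seven {h : Fin 7 → Fin 7 → ℤ} (hskew : ∀ a b, h b a = -h a b)
    (hodd : ∀ a b, a ≠ b → Odd (h a b)) (hle : ∀ a b, |h a b| ≤ 7) (hrow : ∀ a, ∑ b, h a b = 0)
    (hmod : ∀ a b, (7 : ℤ) ∣ h a b - (h 0 b - h 0 a)) (hsum : 1148 ≤ ∑ a, ∑ b, h a b ^ 2)
    {a b : Fin 7} (hab : a ≠ b) : |h a b| = 7 := by
  set f : Fin 7 → ZMod 7 := fun a => (h 0 a : ZMod 7) with hf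
  have hcast : ∀ a b, (h a b : ZMod 7) = f b - f a := fun a b => by
    rw [← sub_eq_zero]
    have := (ZMod.intCast_zmod_eq_zero_iff_dvd (h a b - (h 0 b - h 0 a)) 7).2
      (by exact_mod_cast hmod a b)
    simpa [hf] using this
  set m : ZMod 7 → ℕ := fun d => (Finset.univ.filter fun a => f a = d).card with hm
  -- the rows with `f a = c` sum to zero, and within the class of `c` the entries cancel by skewness
  have hbal : ∀ c, m c = 0 ∨ ∑ d, (m d : ℤ) * oddRep (d - c) = 0 := by
    intro c
    have h1 : ∑ a ∈ Finset.univ.filter fun a => f a = c, ∑ b, h a b = 0 :=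
      Finset.sum_eq_zero fun a _ => hrow a
    have h2 : ∀ a ∈ Finset.univ.filter fun a => f a = c, ∑ b, h a b =
        ∑ b ∈ Finset.univ.filter fun a => f a = c, h a b + ∑ d, (m d : ℤ) * oddRep (d - c) := by
      intro a ha
      have ha : f a = c := by simpa using ha
      rw [← sum_comp_eq f fun d => oddRep (d - c), Finset.sum_filter, ← Finset.sum_add_distrib]
      refine Finset.sum_congr rfl fun b _ => ?_
      split_ifs with hb
      · rw [hb, sub_self]; simp [oddRep]
      · have hne : (h a b : ZMod 7) ≠ 0 := by
          rw [hcast, ha]; exact sub_ne_zero.2 hb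
        have hab : a ≠ b := fun he => hb (he ▸ ha)
        rw [zero_add, ← ha, ← hcast]
        exact eq_oddRep (hle a b) (hodd a b hab) hne
    have h3 : ∑ a ∈ Finset.univ.filter fun a => f a = c,
        ∑ b ∈ Finset.univ.filter fun a => f a = c, h a b = 0 := by
      have h4 : ∑ a ∈ Finset.univ.filter fun a => f a = c,
          ∑ b ∈ Finset.univ.filter fun a => f a = c, h a b =
          ∑ a ∈ Finset.univ.filter fun a => f a = c,
          ∑ b ∈ Finset.univ.filter fun a => f a = c, -h a b := by
        rw [Finset.sum_comm]
        exact Finset.sum_congr rfl fun a _ => Finset.sum_congr rfl fun b _ => hskew a b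
      simp only [Finset.sum_neg_distrib] at h4
      linarith
    rw [Finset.sum_congr rfl h2, Finset.sum_add_distrib, h3, Finset.sum_const, zero_add,
      nsmul_eq_mul, mul_eq_zero] at h1
    exact h1.imp_left fun h => by exact_mod_cast h
  have htot : ∑ d, m d = 7 := by
    have := sum_comp_eq f fun _ => 1
    simp only [mul_one] at this
    have h7 : (∑ d, (m d : ℤ)) = 7 := by rw [← this]; simp
    exact_mod_cast h7
  -- `1491 = 1148 + 7 * 49`, as `oddRepSq` counts the seven diagonal entries as `49`
  have hsq : 1491 ≤ ∑ c, ∑ d, (m c : ℤ) * (m d * oddRepSq (d - c)) := by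
    have h1 : ∀ a b, h a b ^ 2 + (if a = b then 49 else 0) ≤ oddRepSq (f b - f a) := by
      intro a b
      split_ifs with hab
      · have : h b b = 0 := self_eq_neg.1 (hskew b b)
        rw [hab, this, sub_self]; simp [oddRepSq]
      · rw [← hcast, add_zero]
        exact sq_le_oddRepSq (hle a b) (hodd a b hab)
    have h2 := Finset.sum_le_sum fun a (_ : a ∈ Finset.univ) =>
      Finset.sum_le_sum fun b (_ : b ∈ Finset.univ) => h1 a b
    have h3 : ∀ c, ∑ b, oddRepSq (f b - c) = ∑ d, (m d : ℤ) * oddRepSq (d - c) := fun c =>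
      sum_comp_eq f fun d => oddRepSq (d - c)
    simp only [h3] at h2
    rw [sum_comp_eq f fun c => ∑ d, (m d : ℤ) * oddRepSq (d - c)] at h2
    simp only [Finset.sum_add_distrib, Finset.mul_sum] at h2
    simp at h2
    linarith
  obtain ⟨c, hc⟩ := exists_eq_seven hbal htot hsq
  have huniv : (Finset.univ.filter fun a => f a = c) = Finset.univ :=
    Finset.eq_univ_of_card _ (by rw [← hm] at *; simpa using hc)
  have hall : ∀ a, f a = c := fun a => by
    have := Finset.mem_univ a
    rw [← huniv] at this
    simpa using this
  have h0 : (7 : ℤ) ∣ h a b := by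
    have := hcast a b
    rw [hall, hall, sub_self] at this
    exact_mod_cast (ZMod.intCast_zmod_eq_zero_iff_dvd (h a b) 7).1 this
  have h1 := hle a b
  have h2 := hodd a b hab
  generalize h a b = n at h0 h1 h2
  obtain ⟨k, rfl⟩ := h0
  obtain ⟨h3, h4⟩ := abs_le.1 h1
  have h5 : -1 ≤ k := by omega
  have h6 : k ≤ 1 := by omega
  interval_cases k
  · rfl
  · exact absurd h2 (by decide)
  · rfl

/-! ### The dual matrix of an alternating form on four indices -/

/-- The alternating sum of the values of `O` at the faces of a 5-tuple. -/
def coface (O : Fin 7 → Fin 7 → Fin 7 → Fin 7 → ℤ) (i j k l m : Fin 7) : ℤ :=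
  O j k l m - O i k l m + O i j l m - O i j k m + O i j k l

/-- The skew-symmetric matrix whose entry at `(a, b)`, for `a < b`, is the value of `T` at the
increasing 5-tuple omitting `a` and `b`, with the sign `(-1) ^ (a + b + 1)`. -/
def dualMatrix (T : Fin 7 → Fin 7 → Fin 7 → Fin 7 → Fin 7 → ℤ) : Fin 7 → Fin 7 → ℤ :=
  ![![0, T 2 3 4 5 6, -T 1 3 4 5 6, T 1 2 4 5 6,
      -T 1 2 3 5 6, T 1 2 3 4 6, -T 1 2 3 4 5],
    ![-T 2 3 4 5 6, 0, T 0 3 4 5 6, -T 0 2 4 5 6,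
      T 0 2 3 5 6, -T 0 2 3 4 6, T 0 2 3 4 5],
    ![T 1 3 4 5 6, -T 0 3 4 5 6, 0, T 0 1 4 5 6,
      -T 0 1 3 5 6, T 0 1 3 4 6, -T 0 1 3 4 5],
    ![-T 1 2 4 5 6, T 0 2 4 5 6, -T 0 1 4 5 6, 0,
      T 0 1 2 5 6, -T 0 1 2 4 6, T 0 1 2 4 5],
    ![T 1 2 3 5 6, -T 0 2 3 5 6, T 0 1 3 5 6, -T 0 1 2 5 6,
      0, T 0 1 2 3 6, -T 0 1 2 3 5],
    ![-T 1 2 3 4 6, T 0 2 3 4 6, -T 0 1 3 4 6, T 0 1 2 4 6,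
      -T 0 1 2 3 6, 0, T 0 1 2 3 4],
    ![T 1 2 3 4 5, -T 0 2 3 4 5, T 0 1 3 4 5, -T 0 1 2 4 5,
      T 0 1 2 3 5, -T 0 1 2 3 4, 0]]

/-- The sum of the squares of the values of `O` at increasing 4-tuples. -/
def sumSq (O : Fin 7 → Fin 7 → Fin 7 → Fin 7 → ℤ) : ℤ :=
  O 0 1 2 3 ^ 2 + O 0 1 2 4 ^ 2 + O 0 1 2 5 ^ 2 + O 0 1 2 6 ^ 2 + O 0 1 3 4 ^ 2 +
      O 0 1 3 5 ^ 2 + O 0 1 3 6 ^ 2 + O 0 1 4 5 ^ 2 + O 0 1 4 6 ^ 2 + O 0 1 5 6 ^ 2 +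
      O 0 2 3 4 ^ 2 + O 0 2 3 5 ^ 2 + O 0 2 3 6 ^ 2 + O 0 2 4 5 ^ 2 + O 0 2 4 6 ^ 2 +
      O 0 2 5 6 ^ 2 + O 0 3 4 5 ^ 2 + O 0 3 4 6 ^ 2 + O 0 3 5 6 ^ 2 + O 0 4 5 6 ^ 2 +
      O 1 2 3 4 ^ 2 + O 1 2 3 5 ^ 2 + O 1 2 3 6 ^ 2 + O 1 2 4 5 ^ 2 + O 1 2 4 6 ^ 2 +
      O 1 2 5 6 ^ 2 + O 1 3 4 5 ^ 2 + O 1 3 4 6 ^ 2 + O 1 3 5 6 ^ 2 + O 1 4 5 6 ^ 2 +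
      O 2 3 4 5 ^ 2 + O 2 3 4 6 ^ 2 + O 2 3 5 6 ^ 2 + O 2 4 5 6 ^ 2 + O 3 4 5 6 ^ 2

/-- Integral alternating 4-tensors on `{0, …, 6}` with zero contraction, given by their values at
distinct indices; the values of `O` elsewhere are irrelevant. -/
structure SkewForm (O : Fin 7 → Fin 7 → Fin 7 → Fin 7 → ℤ) : Prop where
  swap_left : ∀ i j k l, [i, j, k, l].Nodup → O j i k l = -O i j k l
  swap_mid : ∀ i j k l, [i, j, k, l].Nodup → O i k j l = -O i j k l
  swap_right : ∀ i j k l, [i, j, k, l].Nodup → O i j l k = -O i j k l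
  sum_eq_zero : ∀ i j k, i ≠ j → i ≠ k → j ≠ k →
    ∑ l, (if l = i ∨ l = j ∨ l = k then 0 else O i j k l) = 0

theorem dualMatrix_induction {T : Fin 7 → Fin 7 → Fin 7 → Fin 7 → Fin 7 → ℤ} {P : ℤ → Prop}
    (hT : ∀ i j k l m, [i, j, k, l, m].Nodup → P (T i j k l m)) (hneg : ∀ n, P n → P (-n))
    (a b : Fin 7) (hab : a ≠ b) : P (dualMatrix T a b) := by
  fin_cases a <;> fin_cases b <;>
    first
    | exact absurd rfl hab
    | exact hT _ _ _ _ _ (by decide)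
    | exact hneg _ (hT _ _ _ _ _ (by decide))

theorem dualMatrix_skew (T : Fin 7 → Fin 7 → Fin 7 → Fin 7 → Fin 7 → ℤ) (a b : Fin 7) :
    dualMatrix T b a = -dualMatrix T a b := by
  fin_cases a <;> fin_cases b <;> first | rfl | exact (neg_neg _).symm

theorem sum_dualMatrix_coface (O : Fin 7 → Fin 7 → Fin 7 → Fin 7 → ℤ) (a : Fin 7) :
    ∑ b, dualMatrix (coface O) a b = 0 := by
  rw [Fin.sum_univ_seven]
  fin_cases a <;> simp [dualMatrix, coface] <;> ring

namespace SkewForm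

variable {O : Fin 7 → Fin 7 → Fin 7 → Fin 7 → ℤ}

/-- The values at 4-tuples containing `0` in terms of those at the other 4-tuples. -/
theorem zero_eqs (h : SkewForm O) :
    O 0 1 2 3 = O 1 2 3 4 + O 1 2 3 5 + O 1 2 3 6 ∧
    O 0 1 2 4 = -O 1 2 3 4 + O 1 2 4 5 + O 1 2 4 6 ∧
    O 0 1 2 5 = -O 1 2 3 5 - O 1 2 4 5 + O 1 2 5 6 ∧
    O 0 1 2 6 = -O 1 2 3 6 - O 1 2 4 6 - O 1 2 5 6 ∧
    O 0 1 3 4 = O 1 2 3 4 + O 1 3 4 5 + O 1 3 4 6 ∧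
    O 0 1 3 5 = O 1 2 3 5 - O 1 3 4 5 + O 1 3 5 6 ∧
    O 0 1 3 6 = O 1 2 3 6 - O 1 3 4 6 - O 1 3 5 6 ∧
    O 0 1 4 5 = O 1 2 4 5 + O 1 3 4 5 + O 1 4 5 6 ∧
    O 0 1 4 6 = O 1 2 4 6 + O 1 3 4 6 - O 1 4 5 6 ∧
    O 0 1 5 6 = O 1 2 5 6 + O 1 3 5 6 + O 1 4 5 6 ∧
    O 0 2 3 4 = -O 1 2 3 4 + O 2 3 4 5 + O 2 3 4 6 ∧
    O 0 2 3 5 = -O 1 2 3 5 - O 2 3 4 5 + O 2 3 5 6 ∧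
    O 0 2 3 6 = -O 1 2 3 6 - O 2 3 4 6 - O 2 3 5 6 ∧
    O 0 2 4 5 = -O 1 2 4 5 + O 2 3 4 5 + O 2 4 5 6 ∧
    O 0 2 4 6 = -O 1 2 4 6 + O 2 3 4 6 - O 2 4 5 6 ∧
    O 0 2 5 6 = -O 1 2 5 6 + O 2 3 5 6 + O 2 4 5 6 ∧
    O 0 3 4 5 = -O 1 3 4 5 - O 2 3 4 5 + O 3 4 5 6 ∧
    O 0 3 4 6 = -O 1 3 4 6 - O 2 3 4 6 - O 3 4 5 6 ∧
    O 0 3 5 6 = -O 1 3 5 6 - O 2 3 5 6 + O 3 4 5 6 ∧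
    O 0 4 5 6 = -O 1 4 5 6 - O 2 4 5 6 - O 3 4 5 6 := by
  -- the inequalities make the transpositions usable for sorting the indices
  have s34 : ∀ i j k l, l < k → [i, j, l, k].Nodup → O i j k l = -O i j l k :=
    fun i j k l _ h' => h.swap_right i j l k h'
  have s23 : ∀ i j k l, k < j → [i, k, j, l].Nodup → O i j k l = -O i k j l :=
    fun i j k l _ h' => h.swap_mid i k j l h'
  have s12 : ∀ i j k l, j < i → [j, i, k, l].Nodup → O i j k l = -O j i k l :=
    fun i j k l _ h' => h.swap_left j i k l h'
  have r123 := h.sum_eq_zero 1 2 3 (by decide) (by decide) (by decide)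
  have r124 := h.sum_eq_zero 1 2 4 (by decide) (by decide) (by decide)
  have r125 := h.sum_eq_zero 1 2 5 (by decide) (by decide) (by decide)
  have r126 := h.sum_eq_zero 1 2 6 (by decide) (by decide) (by decide)
  have r134 := h.sum_eq_zero 1 3 4 (by decide) (by decide) (by decide)
  have r135 := h.sum_eq_zero 1 3 5 (by decide) (by decide) (by decide)
  have r136 := h.sum_eq_zero 1 3 6 (by decide) (by decide) (by decide)
  have r145 := h.sum_eq_zero 1 4 5 (by decide) (by decide) (by decide)
  have r146 := h.sum_eq_zero 1 4 6 (by decide) (by decide) (by decide)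
  have r156 := h.sum_eq_zero 1 5 6 (by decide) (by decide) (by decide)
  have r234 := h.sum_eq_zero 2 3 4 (by decide) (by decide) (by decide)
  have r235 := h.sum_eq_zero 2 3 5 (by decide) (by decide) (by decide)
  have r236 := h.sum_eq_zero 2 3 6 (by decide) (by decide) (by decide)
  have r245 := h.sum_eq_zero 2 4 5 (by decide) (by decide) (by decide)
  have r246 := h.sum_eq_zero 2 4 6 (by decide) (by decide) (by decide)
  have r256 := h.sum_eq_zero 2 5 6 (by decide) (by decide) (by decide)
  have r345 := h.sum_eq_zero 3 4 5 (by decide) (by decide) (by decide)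
  have r346 := h.sum_eq_zero 3 4 6 (by decide) (by decide) (by decide)
  have r356 := h.sum_eq_zero 3 5 6 (by decide) (by decide) (by decide)
  have r456 := h.sum_eq_zero 4 5 6 (by decide) (by decide) (by decide)
  rw [Fin.sum_univ_seven]
    at r123 r124 r125 r126 r134 r135 r136 r145 r146 r156 r234 r235 r236 r245 r246 r256 r345 r346
      r356 r456
  simp (disch := decide) [s34, s23, s12]
    at r123 r124 r125 r126 r134 r135 r136 r145 r146 r156 r234 r235 r236 r245 r246 r256 r345 r346
      r356 r456
  refine ⟨?_, ?_, ?_, ?_, ?_, ?_, ?_, ?_, ?_, ?_, ?_, ?_, ?_, ?_, ?_, ?_, ?_, ?_, ?_, ?_⟩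
  · linarith only [r123]
  · linarith only [r124]
  · linarith only [r125]
  · linarith only [r126]
  · linarith only [r134]
  · linarith only [r135]
  · linarith only [r136]
  · linarith only [r145]
  · linarith only [r146]
  · linarith only [r156]
  · linarith only [r234]
  · linarith only [r235]
  · linarith only [r236]
  · linarith only [r245]
  · linarith only [r246]
  · linarith only [r256]
  · linarith only [r345]
  · linarith only [r346]
  · linarith only [r356]
  · linarith only [r456]

set_option maxHeartbeats 2000000 in
/-- The vanishing contraction determines `O` by its values at 4-tuples without `0`, and in terms of
these the coefficients of `h a b - h 0 b + h 0 a` are divisible by `7`. -/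
theorem dvd_dualMatrix_coface (h : SkewForm O) (a b : Fin 7) :
    (7 : ℤ) ∣ dualMatrix (coface O) a b -
      (dualMatrix (coface O) 0 b - dualMatrix (coface O) 0 a) := by
  have key : ∀ a b : Fin 7, a ≠ 0 → a < b → (7 : ℤ) ∣ dualMatrix (coface O) a b -
      (dualMatrix (coface O) 0 b - dualMatrix (coface O) 0 a) := by
    obtain ⟨e123, e124, e125, e126, e134, e135, e136, e145, e146, e156, e234, e235, e236, e245,
      e246, e256, e345, e346, e356, e456⟩ := h.zero_eqs
    intro a b ha hab
    fin_cases a <;> fin_cases b <;>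
      first | exact absurd rfl ha | exact absurd hab (by decide) | skip
    all_goals
      simp [dualMatrix, coface, e123, e124, e125, e126, e134, e135, e136, e145, e146, e156, e234,
        e235, e236, e245, e246, e256, e345, e346, e356, e456]
      clear e123 e124 e125 e126 e134 e135 e136 e145 e146 e156 e234 e235 e236 e245 e246 e256 e345
        e346 e356 e456
      omega
  have hs := dualMatrix_skew (coface O)
  have h0 : ∀ a, dualMatrix (coface O) a a = 0 := fun a => self_eq_neg.1 (hs a a)
  rcases eq_or_ne a 0 with rfl | ha
  · simp [h0]
  rcases eq_or_ne b 0 with rfl | hb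
  · rw [h0, hs 0 a]; simp
  rcases lt_trichotomy a b with hab | rfl | hab
  · exact key a b ha hab
  · simp [h0]
  · have e : dualMatrix (coface O) a b - (dualMatrix (coface O) 0 b - dualMatrix (coface O) 0 a) =
        -(dualMatrix (coface O) b a - (dualMatrix (coface O) 0 a - dualMatrix (coface O) 0 b)) := by
      rw [hs b a]; ring
    rw [e, dvd_neg]
    exact key b a hb hab

set_option maxHeartbeats 2000000 in
/-- On forms with zero contraction, the coboundary multiplies the squared length by `7`; each
5-tuple occurs twice in the dual matrix. -/
theorem sum_sq_dualMatrix_coface (h : SkewForm O) :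
    ∑ a, ∑ b, dualMatrix (coface O) a b ^ 2 = 14 * sumSq O := by
  obtain ⟨e123, e124, e125, e126, e134, e135, e136, e145, e146, e156, e234, e235, e236, e245, e246,
    e256, e345, e346, e356, e456⟩ := h.zero_eqs
  simp only [Fin.sum_univ_seven]
  simp [dualMatrix, coface, sumSq, e123, e124, e125, e126, e134, e135, e136, e145, e146, e156, e234,
    e235, e236, e245, e246, e256, e345, e346, e356, e456]
  ring

theorem coface_odd (hodd : ∀ i j k l, [i, j, k, l].Nodup → Odd (O i j k l)) (i j k l m : Fin 7)
    (hn : [i, j, k, l, m].Nodup) : Odd (coface O i j k l m) := by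
  obtain ⟨hij, hik, hil, him, hjk, hjl, hjm, hkl, hkm, hlm⟩ := nodup_five.1 hn
  have h1 := hodd _ _ _ _ (nodup_four.2 ⟨hjk, hjl, hjm, hkl, hkm, hlm⟩)
  have h2 := hodd _ _ _ _ (nodup_four.2 ⟨hik, hil, him, hkl, hkm, hlm⟩)
  have h3 := hodd _ _ _ _ (nodup_four.2 ⟨hij, hil, him, hjl, hjm, hlm⟩)
  have h4 := hodd _ _ _ _ (nodup_four.2 ⟨hij, hik, him, hjk, hjm, hkm⟩)
  have h5 := hodd _ _ _ _ (nodup_four.2 ⟨hij, hik, hil, hjk, hjl, hkl⟩)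
  exact (((h1.sub_odd h2).add_odd h3).sub_odd h4).add_odd h5

theorem abs_dualMatrix_coface (h : SkewForm O)
    (hodd : ∀ i j k l, [i, j, k, l].Nodup → Odd (O i j k l))
    (hle : ∀ i j k l m, [i, j, k, l, m].Nodup → |coface O i j k l m| ≤ 7) (hsum : 82 ≤ sumSq O)
    {a b : Fin 7} (hab : a ≠ b) : |dualMatrix (coface O) a b| = 7 := by
  refine abs_eq_seven (dualMatrix_skew _) ?_ ?_ (sum_dualMatrix_coface O)
    h.dvd_dualMatrix_coface ?_ hab
  · exact dualMatrix_induction (coface_odd hodd) fun n hn => hn.neg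
  · intro a b
    rcases eq_or_ne a b with rfl | hab
    · rw [self_eq_neg.1 (dualMatrix_skew (coface O) a a)]; norm_num
    · exact dualMatrix_induction (P := fun n => |n| ≤ 7) hle (fun n hn => by rwa [abs_neg]) a b hab
  · rw [h.sum_sq_dualMatrix_coface]; linarith

end SkewForm

/-! ### All triangle inner products are extremal -/

theorem sum_lt_eq {M : Type*} [AddCommMonoid M] (f : Fin 7 → Fin 7 → M) :
    ∑ k, ∑ l, (if k < l then f k l else 0) =
      f 0 1 + f 0 2 + f 0 3 + f 0 4 + f 0 5 + f 0 6 + f 1 2 + f 1 3 + f 1 4 + f 1 5 + f 1 6 +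
      f 2 3 + f 2 4 + f 2 5 + f 2 6 + f 3 4 + f 3 5 + f 3 6 + f 4 5 + f 4 6 + f 5 6 := by
  simp only [Fin.sum_univ_seven]
  simp [Fin.reduceLT, add_assoc]

namespace SkewSystem

variable {E : Type*} [NormedAddCommGroup E] [InnerProductSpace ℝ E]
  {A B : AddSubgroup E} {X Y : Finset E} {α : E} {b : Fin 7 → Fin 7 → E}

/-- The squares of `om b` on pairs of pairs are `25` for each of the `21` equal pairs and `1` for
the `210` sharing one index, and `1225 - 21 * 25 - 210 = 490`; each of the other values appears six
times. -/
theorem le_sum_om_sq (s : SkewSystem B Y α b) (hp : DesignPair A B X Y 1 7)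
    (h : 1225 ≤ ∑ i, ∑ j, if i < j then ∑ k, ∑ l, (if k < l then om b i j k l ^ 2 else 0) else 0) :
    490 ≤ 6 * (om b 0 1 2 3 ^ 2 + om b 0 1 2 4 ^ 2 + om b 0 1 2 5 ^ 2 +
      om b 0 1 2 6 ^ 2 + om b 0 1 3 4 ^ 2 +
      om b 0 1 3 5 ^ 2 + om b 0 1 3 6 ^ 2 + om b 0 1 4 5 ^ 2 + om b 0 1 4 6 ^ 2 + om b 0 1 5 6 ^ 2 +
      om b 0 2 3 4 ^ 2 + om b 0 2 3 5 ^ 2 + om b 0 2 3 6 ^ 2 + om b 0 2 4 5 ^ 2 + om b 0 2 4 6 ^ 2 +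
      om b 0 2 5 6 ^ 2 + om b 0 3 4 5 ^ 2 + om b 0 3 4 6 ^ 2 + om b 0 3 5 6 ^ 2 + om b 0 4 5 6 ^ 2 +
      om b 1 2 3 4 ^ 2 + om b 1 2 3 5 ^ 2 + om b 1 2 3 6 ^ 2 + om b 1 2 4 5 ^ 2 + om b 1 2 4 6 ^ 2 +
      om b 1 2 5 6 ^ 2 + om b 1 3 4 5 ^ 2 + om b 1 3 4 6 ^ 2 + om b 1 3 5 6 ^ 2 + om b 1 4 5 6 ^ 2 +
      om b 2 3 4 5 ^ 2 + om b 2 3 4 6 ^ 2 + om b 2 3 5 6 ^ 2 + om b 2 4 5 6 ^ 2 +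
      om b 3 4 5 6 ^ 2) := by
  have c1 : ∀ i j k l, k < i → om b i j k l ^ 2 = om b k l i j ^ 2 := fun i j k l _ => by
    rw [SkewSystem.om_symm]
  have c2 : ∀ i j k l, k < j → [i, k, j, l].Nodup → om b i j k l ^ 2 = om b i k j l ^ 2 :=
    fun i j k l _ hn => by rw [s.om_swap_mid hp hn, neg_sq]
  have c3 : ∀ i j k l, l < k → om b i j k l ^ 2 = om b i j l k ^ 2 := fun i j k l _ => by
    rw [s.om_swap_right, neg_sq]
  have d0 : ∀ i j, i ≠ j → om b i j i j ^ 2 = 25 := fun i j hij => by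
    rw [om, s.inner_self i j hij]; norm_num
  have d1 : ∀ i j k, i ≠ j → i ≠ k → j ≠ k → om b i j i k ^ 2 = 1 := fun i j k h1 h2 h3 => by
    rw [om, s.inner_share i j k h1 h2 h3]; norm_num
  have d2 : ∀ i j k, i ≠ j → i ≠ k → j ≠ k → om b j i i k ^ 2 = 1 := fun i j k h1 h2 h3 => by
    rw [om, s.share_left h1 h2 h3]; norm_num
  have d3 : ∀ i j k, i ≠ j → i ≠ k → j ≠ k → om b i j k i ^ 2 = 1 := fun i j k h1 h2 h3 => by
    rw [om, s.share_right h1 h2 h3]; norm_num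
  have d4 : ∀ i j k, i ≠ j → i ≠ k → j ≠ k → om b j i k i ^ 2 = 1 := fun i j k h1 h2 h3 => by
    rw [om, s.share_both h1 h2 h3]; norm_num
  simp only [sum_lt_eq] at h
  simp (disch := decide) only [d0, d1, d2, d3, d4] at h
  simp (disch := decide) only [c1, c2, c3] at h
  linarith

/-- The trace inequality for the `21` vectors `b i j`, `i < j`, of norm `5 / 4` in dimension `9`,
where `1225 = 16 * (21 * 5 / 4) ^ 2 / 9`. -/
theorem le_trace (s : SkewSystem B Y α b)
    (htr : ∀ c : Fin 7 × Fin 7 → ℝ,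
      (∑ i, inner ℝ (c i • b i.1 i.2) (c i • b i.1 i.2)) ^ 2 ≤
        9 * ∑ i, ∑ j, inner ℝ (c i • b i.1 i.2) (c j • b j.1 j.2) ^ 2) :
    1225 ≤ ∑ i, ∑ j,
      if i < j then ∑ k, ∑ l, (if k < l then om b i j k l ^ 2 else 0) else 0 := by
  have h := htr fun i => if i.1 < i.2 then 1 else 0
  simp only [Fintype.sum_prod_type] at h
  have h1 : ∑ i, ∑ j, inner ℝ ((if i < j then (1 : ℝ) else 0) • b i j)
      ((if i < j then (1 : ℝ) else 0) • b i j) = 105 / 4 := by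
    have : ∀ i j, inner ℝ ((if i < j then (1 : ℝ) else 0) • b i j)
      ((if i < j then (1 : ℝ) else 0) • b i j) = if i < j then (5 / 4 : ℝ) else 0 := fun i j => by
      split_ifs with hij
      · rw [one_smul, s.inner_self i j hij.ne]
      · simp
    simp only [this, sum_lt_eq]
    norm_num
  have h2 : ∑ i, ∑ j, ∑ k, ∑ l, inner ℝ ((if i < j then (1 : ℝ) else 0) • b i j)
      ((if k < l then (1 : ℝ) else 0) • b k l) ^ 2 = (∑ i, ∑ j,
      if i < j then ∑ k, ∑ l, (if k < l then om b i j k l ^ 2 else 0) else 0) / 16 := by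
    rw [Finset.sum_div]
    refine Finset.sum_congr rfl fun i _ => ?_
    rw [Finset.sum_div]
    refine Finset.sum_congr rfl fun j _ => ?_
    split_ifs with hij
    · rw [Finset.sum_div]
      refine Finset.sum_congr rfl fun k _ => ?_
      rw [Finset.sum_div]
      refine Finset.sum_congr rfl fun l _ => ?_
      split_ifs with hkl
      · rw [one_smul, one_smul, om]; ring
      · simp
    · simp
  rw [h1, h2] at h
  linarith

theorem exists_skewForm (s : SkewSystem B Y α b) (hp : DesignPair A B X Y 1 7) :
    ∃ O : Fin 7 → Fin 7 → Fin 7 → Fin 7 → ℤ, SkewForm O ∧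
      ∀ i j k l, [i, j, k, l].Nodup → Odd (O i j k l) ∧ om b i j k l = O i j k l := by
  have hex : ∀ i j k l, ∃ z : ℤ, [i, j, k, l].Nodup → Odd z ∧ om b i j k l = (z : ℝ) :=
    fun i j k l => by
      by_cases hn : [i, j, k, l].Nodup
      · obtain ⟨z, hz⟩ := s.om_odd hn
        exact ⟨z, fun _ => hz⟩
      · exact ⟨0, fun h => (hn h).elim⟩
  choose O hO using hex
  refine ⟨O, ⟨?_, ?_, ?_, ?_⟩, hO⟩
  · intro i j k l hn
    have hn' : [j, i, k, l].Nodup := (List.Perm.swap j i [k, l]).nodup_iff.1 hn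
    have : (O j i k l : ℝ) = -O i j k l := by
      rw [← (hO _ _ _ _ hn).2, ← (hO _ _ _ _ hn').2, s.om_swap_left]
    exact_mod_cast this
  · intro i j k l hn
    have hn' : [i, k, j, l].Nodup := ((List.Perm.swap k j [l]).cons i).nodup_iff.1 hn
    have : (O i k j l : ℝ) = -O i j k l := by
      rw [← (hO _ _ _ _ hn).2, ← (hO _ _ _ _ hn').2, s.om_swap_mid hp hn]
    exact_mod_cast this
  · intro i j k l hn
    have hn' : [i, j, l, k].Nodup := (((List.Perm.swap l k []).cons j).cons i).nodup_iff.1 hn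
    have : (O i j l k : ℝ) = -O i j k l := by
      rw [← (hO _ _ _ _ hn).2, ← (hO _ _ _ _ hn').2, s.om_swap_right]
    exact_mod_cast this
  · intro i j k hij hik hjk
    obtain ⟨e1, e2, e3⟩ := s.om_share hij hik hjk
    have h1 : ∀ l, om b i j k l = ((if l = i ∨ l = j ∨ l = k then 0 else O i j k l : ℤ) : ℝ) +
        (if l = i then 1 else 0) - (if l = j then 1 else 0) := by
      intro l
      rcases eq_or_ne l i with rfl | hi
      · rw [e1]; simp [hij]
      rcases eq_or_ne l j with rfl | hj
      · rw [e2]; simp [hi]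
      rcases eq_or_ne l k with rfl | hk
      · rw [e3]; simp [hi, hj]
      rw [(hO _ _ _ _ (nodup_four.2 ⟨hij, hik, hi.symm, hjk, hj.symm, hk.symm⟩)).2]
      simp [hi, hj, hk]
    have h2 := s.sum_om_eq_zero i j k
    simp only [h1, Finset.sum_sub_distrib, Finset.sum_add_distrib] at h2
    rw [Finset.sum_ite_eq' Finset.univ i, Finset.sum_ite_eq' Finset.univ j] at h2
    simp only [Finset.mem_univ, if_true] at h2
    have h3 : ((∑ l, (if l = i ∨ l = j ∨ l = k then 0 else O i j k l) : ℤ) : ℝ) = 0 := by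
      rw [Int.cast_sum]; linarith
    exact_mod_cast h3

/-- The trace inequality forces all values of `theta b` at five distinct indices to be `±7`. -/
theorem exists_dualMatrix (s : SkewSystem B Y α b) (hp : DesignPair A B X Y 1 7)
    (htr : ∀ c : Fin 7 × Fin 7 → ℝ,
      (∑ i, inner ℝ (c i • b i.1 i.2) (c i • b i.1 i.2)) ^ 2 ≤
        9 * ∑ i, ∑ j, inner ℝ (c i • b i.1 i.2) (c j • b j.1 j.2) ^ 2) :
    ∃ T : Fin 7 → Fin 7 → Fin 7 → Fin 7 → Fin 7 → ℤ,
      (∀ i j k l m, [i, j, k, l, m].Nodup → theta b i j k l m = T i j k l m) ∧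
      (∀ a, ∑ c, dualMatrix T a c = 0) ∧ ∀ a c, a ≠ c → |dualMatrix T a c| = 7 := by
  obtain ⟨O, hO, hO'⟩ := s.exists_skewForm hp
  have hT : ∀ i j k l m, [i, j, k, l, m].Nodup →
      theta b i j k l m = (coface O i j k l m : ℤ) := by
    intro i j k l m hn
    obtain ⟨hij, hik, hil, him, hjk, hjl, hjm, hkl, hkm, hlm⟩ := nodup_five.1 hn
    rw [theta, coface, (hO' _ _ _ _ (nodup_four.2 ⟨hjk, hjl, hjm, hkl, hkm, hlm⟩)).2,
      (hO' _ _ _ _ (nodup_four.2 ⟨hik, hil, him, hkl, hkm, hlm⟩)).2,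
      (hO' _ _ _ _ (nodup_four.2 ⟨hij, hil, him, hjl, hjm, hlm⟩)).2,
      (hO' _ _ _ _ (nodup_four.2 ⟨hij, hik, him, hjk, hjm, hkm⟩)).2,
      (hO' _ _ _ _ (nodup_four.2 ⟨hij, hik, hil, hjk, hjl, hkl⟩)).2]
    push_cast; ring
  refine ⟨coface O, hT, sum_dualMatrix_coface O, fun a c hac =>
    hO.abs_dualMatrix_coface (fun i j k l hn => (hO' i j k l hn).1) ?_ ?_ hac⟩
  · intro i j k l m hn
    have := s.abs_theta_le hp hn
    rw [hT _ _ _ _ _ hn] at this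
    exact_mod_cast this
  · have h1 := s.le_sum_om_sq hp (s.le_trace htr)
    have h2 : ∀ i j k l, [i, j, k, l].Nodup → om b i j k l = (O i j k l : ℝ) :=
      fun i j k l hn => (hO' i j k l hn).2
    simp (disch := decide) only [h2] at h1
    have h3 : (490 : ℝ) ≤ 6 * (sumSq O : ℤ) := by
      rw [sumSq]; push_cast; exact h1
    have h4 : 490 ≤ 6 * sumSq O := by exact_mod_cast h3
    omega

end SkewSystem

/-! ### Normalization of the signs and the lattice `E₈` -/

namespace SkewSystem

variable {E : Type*} [NormedAddCommGroup E] [InnerProductSpace ℝ E]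
  {A B : AddSubgroup E} {X Y : Finset E} {α : E} {b : Fin 7 → Fin 7 → E}

theorem theta_swap_one (s : SkewSystem B Y α b) (hp : DesignPair A B X Y 1 7) {i j k l m : Fin 7}
    (h : [i, j, k, l, m].Nodup) : theta b i k j l m = -theta b i j k l m := by
  obtain ⟨hij, hik, hil, him, hjk, hjl, hjm, hkl, hkm, hlm⟩ := nodup_five.1 h
  rw [theta, theta, s.om_swap_left j k l m,
    s.om_swap_mid hp (nodup_four.2 ⟨hij, hik, him, hjk, hjm, hkm⟩),
    s.om_swap_mid hp (nodup_four.2 ⟨hij, hik, hil, hjk, hjl, hkl⟩)]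
  ring

theorem theta_swap_two (s : SkewSystem B Y α b) (hp : DesignPair A B X Y 1 7) {i j k l m : Fin 7}
    (h : [i, j, k, l, m].Nodup) : theta b i j l k m = -theta b i j k l m := by
  obtain ⟨hij, hik, hil, him, hjk, hjl, hjm, hkl, hkm, hlm⟩ := nodup_five.1 h
  rw [theta, theta, s.om_swap_mid hp (nodup_four.2 ⟨hjk, hjl, hjm, hkl, hkm, hlm⟩),
    s.om_swap_mid hp (nodup_four.2 ⟨hik, hil, him, hkl, hkm, hlm⟩), s.om_swap_right i j k l]
  ring

theorem theta_swap_three (s : SkewSystem B Y α b) (i j k l m : Fin 7) :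
    theta b i j k m l = -theta b i j k l m := by
  rw [theta, theta, s.om_swap_right j k l m, s.om_swap_right i k l m, s.om_swap_right i j l m]
  ring

end SkewSystem

/-- There are six distinct labels `p, q₀, …, q₄` such that `theta b`, evaluated at `p` and the `q`'s
other than `qᵢ`, is `7 (-1) ^ (i + 1) sᵢ`. -/
def HasSigns {E : Type*} [NormedAddCommGroup E] [InnerProductSpace ℝ E] (b : Fin 7 → Fin 7 → E)
    (s₀ s₁ s₂ s₃ s₄ : ℝ) : Prop :=
  ∃ p q₀ q₁ q₂ q₃ q₄ : Fin 7, [p, q₀, q₁, q₂, q₃, q₄].Nodup ∧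
    theta b p q₁ q₂ q₃ q₄ = -(7 * s₀) ∧ theta b p q₀ q₂ q₃ q₄ = 7 * s₁ ∧
    theta b p q₀ q₁ q₃ q₄ = -(7 * s₂) ∧ theta b p q₀ q₁ q₂ q₄ = 7 * s₃ ∧
    theta b p q₀ q₁ q₂ q₃ = -(7 * s₄)

namespace HasSigns

variable {E : Type*} [NormedAddCommGroup E] [InnerProductSpace ℝ E]
  {A B : AddSubgroup E} {X Y : Finset E} {α : E} {b : Fin 7 → Fin 7 → E} {s₀ s₁ s₂ s₃ s₄ : ℝ}

theorem swap_zero (s : SkewSystem B Y α b) (hp : DesignPair A B X Y 1 7)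
    (h : HasSigns b s₀ s₁ s₂ s₃ s₄) : HasSigns b (-s₁) (-s₀) (-s₂) (-s₃) (-s₄) := by
  obtain ⟨p, q₀, q₁, q₂, q₃, q₄, hn, h0, h1, h2, h3, h4⟩ := h
  refine ⟨p, q₁, q₀, q₂, q₃, q₄, by simp at hn ⊢; tauto, by linarith, by linarith, ?_, ?_, ?_⟩
  · rw [s.theta_swap_one hp, h2]
    · ring
    · simp at hn ⊢; tauto
  · rw [s.theta_swap_one hp, h3]
    · ring
    · simp at hn ⊢; tauto
  · rw [s.theta_swap_one hp, h4]
    · ring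
    · simp at hn ⊢; tauto

theorem swap_one (s : SkewSystem B Y α b) (hp : DesignPair A B X Y 1 7)
    (h : HasSigns b s₀ s₁ s₂ s₃ s₄) : HasSigns b (-s₀) (-s₂) (-s₁) (-s₃) (-s₄) := by
  obtain ⟨p, q₀, q₁, q₂, q₃, q₄, hn, h0, h1, h2, h3, h4⟩ := h
  refine ⟨p, q₀, q₂, q₁, q₃, q₄, by simp at hn ⊢; tauto, ?_, by linarith, by linarith, ?_, ?_⟩
  · rw [s.theta_swap_one hp, h0]
    · ring
    · simp at hn ⊢; tauto
  · rw [s.theta_swap_two hp, h3]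
    · ring
    · simp at hn ⊢; tauto
  · rw [s.theta_swap_two hp, h4]
    · ring
    · simp at hn ⊢; tauto

theorem swap_two (s : SkewSystem B Y α b) (hp : DesignPair A B X Y 1 7)
    (h : HasSigns b s₀ s₁ s₂ s₃ s₄) : HasSigns b (-s₀) (-s₁) (-s₃) (-s₂) (-s₄) := by
  obtain ⟨p, q₀, q₁, q₂, q₃, q₄, hn, h0, h1, h2, h3, h4⟩ := h
  refine ⟨p, q₀, q₁, q₃, q₂, q₄, by simp at hn ⊢; tauto, ?_, ?_, by linarith, by linarith, ?_⟩
  · rw [s.theta_swap_two hp, h0]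
    · ring
    · simp at hn ⊢; tauto
  · rw [s.theta_swap_two hp, h1]
    · ring
    · simp at hn ⊢; tauto
  · rw [s.theta_swap_three, h4]; ring

theorem swap_three (s : SkewSystem B Y α b) (h : HasSigns b s₀ s₁ s₂ s₃ s₄) :
    HasSigns b (-s₀) (-s₁) (-s₂) (-s₄) (-s₃) := by
  obtain ⟨p, q₀, q₁, q₂, q₃, q₄, hn, h0, h1, h2, h3, h4⟩ := h
  refine ⟨p, q₀, q₁, q₂, q₄, q₃, by simp at hn ⊢; tauto, ?_, ?_, ?_, by linarith, by linarith⟩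
  · rw [s.theta_swap_three, h0]; ring
  · rw [s.theta_swap_three, h1]; ring
  · rw [s.theta_swap_three, h2]; ring

/-- All sign patterns with sum `±1` arise from each other by relabelling: exchanging two adjacent
labels exchanges their signs and changes all signs. -/
theorem normalize (s : SkewSystem B Y α b) (hp : DesignPair A B X Y 1 7)
    (h : HasSigns b s₀ s₁ s₂ s₃ s₄) (h0 : s₀ = 1 ∨ s₀ = -1) (h1 : s₁ = 1 ∨ s₁ = -1)
    (h2 : s₂ = 1 ∨ s₂ = -1) (h3 : s₃ = 1 ∨ s₃ = -1) (h4 : s₄ = 1 ∨ s₄ = -1)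
    (hs : s₀ + s₁ + s₂ + s₃ + s₄ = 1 ∨ s₀ + s₁ + s₂ + s₃ + s₄ = -1) :
    HasSigns b 1 1 1 (-1) (-1) := by
  have r0 {s₀ s₁ s₂ s₃ s₄ : ℝ} (h : HasSigns b s₀ s₁ s₂ s₃ s₄) := h.swap_zero s hp
  have r1 {s₀ s₁ s₂ s₃ s₄ : ℝ} (h : HasSigns b s₀ s₁ s₂ s₃ s₄) := h.swap_one s hp
  have r2 {s₀ s₁ s₂ s₃ s₄ : ℝ} (h : HasSigns b s₀ s₁ s₂ s₃ s₄) := h.swap_two s hp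
  have r3 {s₀ s₁ s₂ s₃ s₄ : ℝ} (h : HasSigns b s₀ s₁ s₂ s₃ s₄) := h.swap_three s
  rcases h0 with rfl | rfl <;> rcases h1 with rfl | rfl <;> rcases h2 with rfl | rfl <;>
    rcases h3 with rfl | rfl <;> rcases h4 with rfl | rfl
  · norm_num at hs
  · norm_num at hs
  · norm_num at hs
  · simpa using h
  · norm_num at hs
  · simpa using (r0 (r2 h))
  · simpa using (r2 (r3 h))
  · simpa using (r0 (r2 (r1 (r0 (r3 (r2 (r1 h)))))))
  · norm_num at hs
  · simpa using (r2 (r1 h))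
  · simpa using (r0 (r2 (r1 (r3 h))))
  · simpa using (r2 (r1 (r0 (r3 (r2 h)))))
  · simpa using (r2 (r1 (r3 (r2 h))))
  · simpa using (r0 (r2 (r1 (r0 (r3 h)))))
  · simpa using (r2 (r1 (r0 h)))
  · norm_num at hs
  · norm_num at hs
  · simpa using (r0 (r2 (r1 (r0 h))))
  · simpa using (r2 (r1 (r0 (r3 h))))
  · simpa using (r0 (r2 (r1 (r3 (r2 h)))))
  · simpa using (r0 (r2 (r1 (r0 (r3 (r2 h))))))
  · simpa using (r2 (r1 (r3 h)))
  · simpa using (r0 (r2 (r1 h)))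
  · norm_num at hs
  · simpa using (r2 (r1 (r0 (r3 (r2 (r1 h))))))
  · simpa using (r0 (r2 (r3 h)))
  · simpa using (r2 h)
  · norm_num at hs
  · simpa using (r0 h)
  · norm_num at hs
  · norm_num at hs
  · norm_num at hs

end HasSigns

/-- A Gram matrix of the lattice `E₈`. -/
def gramE8 : Matrix (Fin 8) (Fin 8) ℤ :=
  ![![2, 1, 1, 1, 0, 0, 0, 1],
    ![1, 2, 1, 1, 1, 0, 1, 1],
    ![1, 1, 2, 1, 1, 1, 1, 1],
    ![1, 1, 1, 2, 0, 0, 1, 1],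
    ![0, 1, 1, 0, 2, 1, 1, 1],
    ![0, 0, 1, 0, 1, 2, 1, 1],
    ![0, 1, 1, 1, 1, 1, 2, 1],
    ![1, 1, 1, 1, 1, 1, 1, 2]]

/-- An upper triangular integral matrix whose sum with its transpose is the inverse of `gramE8`. -/
def halfInvGramE8 : Matrix (Fin 8) (Fin 8) ℤ :=
  ![![1, -1, -1, 0, 1, 0, 1, -1],
    ![0, 1, 0, 0, -1, 1, -1, 0],
    ![0, 0, 1, -1, -1, -1, 0, 1],
    ![0, 0, 0, 1, 1, 1, -1, -1],
    ![0, 0, 0, 0, 1, 0, 0, -1],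
    ![0, 0, 0, 0, 0, 1, -1, -1],
    ![0, 0, 0, 0, 0, 0, 1, 0],
    ![0, 0, 0, 0, 0, 0, 0, 1]]

theorem gramE8_mul : gramE8 * (halfInvGramE8 + halfInvGramE8.transpose) = 1 := by
  decide +kernel

theorem gramE8_symm (i j : Fin 8) : gramE8 i j = gramE8 j i := by
  fin_cases i <;> fin_cases j <;> rfl

/-- In the normalized situation, `α` and the vectors `α / 2 + cyc b p q₀ qⱼ` and
`α / 2 + cyc b p q₁ qⱼ` span a copy of `√(7/2) E₈`. -/
theorem HasSigns.false {E : Type*} [NormedAddCommGroup E] [InnerProductSpace ℝ E]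
    {A B : AddSubgroup E} {X Y : Finset E} {α : E} {b : Fin 7 → Fin 7 → E}
    (h : HasSigns b 1 1 1 (-1) (-1)) (s : SkewSystem B Y α b) (hp : DesignPair A B X Y 1 7) :
    False := by
  obtain ⟨p, q₀, q₁, q₂, q₃, q₄, hn, -, -, h2, h3, h4⟩ := h
  have ne : p ≠ q₀ ∧ p ≠ q₁ ∧ p ≠ q₂ ∧ p ≠ q₃ ∧ p ≠ q₄ ∧ q₀ ≠ q₁ ∧ q₀ ≠ q₂ ∧ q₀ ≠ q₃ ∧ q₀ ≠ q₄ ∧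
      q₁ ≠ q₂ ∧ q₁ ≠ q₃ ∧ q₁ ≠ q₄ ∧ q₂ ≠ q₃ ∧ q₂ ≠ q₄ ∧ q₃ ≠ q₄ := by
    simp at hn; tauto
  obtain ⟨p0, p1, p2, p3, p4, n01, n02, n03, n04, n12, n13, n14, n23, n24, n34⟩ := ne
  have hα : inner ℝ α α = 7 := s.inner_alpha_self hp
  have hcα : ∀ j k, inner ℝ ((1 / 2 : ℝ) • α + cyc b p j k) α = 7 / 2 := fun j k => by
    rw [inner_add_left, inner_smul_left, s.inner_cyc_alpha, hα, conj_trivial]; norm_num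
  have self : ∀ j k, p ≠ j → p ≠ k → j ≠ k → inner ℝ ((1 / 2 : ℝ) • α + cyc b p j k)
      ((1 / 2 : ℝ) • α + cyc b p j k) = 7 := fun j k h1 h2 h3 => by
    rw [s.inner_cyc_add hp, s.inner_cyc_self h1 h2 h3]; norm_num
  -- pairs of triples `p j k` with a common second or third label, or with chained labels
  have fst : ∀ j k l, p ≠ j → p ≠ k → p ≠ l → j ≠ k → j ≠ l → k ≠ l →
      inner ℝ ((1 / 2 : ℝ) • α + cyc b p j k) ((1 / 2 : ℝ) • α + cyc b p j l) = 7 / 2 :=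
    fun j k l h1 h2 h3 h4 h5 h6 => by
      rw [s.inner_cyc_add hp, s.inner_cyc_share hp (nodup_four.2 ⟨h1, h2, h3, h4, h5, h6⟩)]
      norm_num
  have snd : ∀ j k l, p ≠ j → p ≠ k → p ≠ l → k ≠ j → l ≠ j → k ≠ l →
      inner ℝ ((1 / 2 : ℝ) • α + cyc b p k j) ((1 / 2 : ℝ) • α + cyc b p l j) = 7 / 2 :=
    fun j k l h1 h2 h3 h4 h5 h6 => by
      rw [s.inner_cyc_add hp, s.cyc_swap p j k, s.cyc_swap p j l, inner_neg_neg,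
        s.inner_cyc_share hp (nodup_four.2 ⟨h1, h2, h3, h4.symm, h5.symm, h6⟩)]
      norm_num
  have chain : ∀ j k l, p ≠ j → p ≠ k → p ≠ l → k ≠ j → j ≠ l → k ≠ l →
      inner ℝ ((1 / 2 : ℝ) • α + cyc b p k j) ((1 / 2 : ℝ) • α + cyc b p j l) = 0 :=
    fun j k l h1 h2 h3 h4 h5 h6 => by
      rw [s.inner_cyc_add hp, s.cyc_swap p j k, inner_neg_left,
        s.inner_cyc_share hp (nodup_four.2 ⟨h1, h2, h3, h4.symm, h5, h6⟩)]
      norm_num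
  have dis : ∀ j k l m, [p, j, k, l, m].Nodup →
      inner ℝ ((1 / 2 : ℝ) • α + cyc b p j l) ((1 / 2 : ℝ) • α + cyc b p k m) =
        7 / 4 - theta b p j k l m / 4 ∧
      inner ℝ ((1 / 2 : ℝ) • α + cyc b p j m) ((1 / 2 : ℝ) • α + cyc b p k l) =
        7 / 4 + theta b p j k l m / 4 := fun j k l m hn => by
    have e1 := s.four_mul_inner_cyc (i := p) (j := j) (k := l) (l := k) (m := m) hp
      (by simp at hn ⊢; tauto)
    have e2 := s.four_mul_inner_cyc (i := p) (j := j) (k := m) (l := k) (m := l) hp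
      (by simp at hn ⊢; tauto)
    have e3 := s.theta_swap_two hp hn
    have e4 := s.theta_swap_two (i := p) (j := j) (k := k) (l := m) (m := l) hp
      (by simp at hn ⊢; tauto)
    rw [s.theta_swap_three p j k l m] at e4
    rw [s.inner_cyc_add hp, s.inner_cyc_add hp]
    constructor <;> linarith
  have d34 := dis q₀ q₁ q₃ q₄ (by simp at hn ⊢; tauto)
  have d24 := dis q₀ q₁ q₂ q₄ (by simp at hn ⊢; tauto)
  have d23 := dis q₀ q₁ q₂ q₃ (by simp at hn ⊢; tauto)
  rw [h2] at d34
  rw [h3] at d24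
  rw [h4] at d23
  let g : Fin 8 → E := ![(1 / 2 : ℝ) • α + cyc b p q₀ q₁, (1 / 2 : ℝ) • α + cyc b p q₀ q₂,
    (1 / 2 : ℝ) • α + cyc b p q₀ q₃, (1 / 2 : ℝ) • α + cyc b p q₀ q₄,
    (1 / 2 : ℝ) • α + cyc b p q₁ q₂, (1 / 2 : ℝ) • α + cyc b p q₁ q₃,
    (1 / 2 : ℝ) • α + cyc b p q₁ q₄, α]
  have v2 : ∀ i j, gramE8 i j = 2 → inner ℝ (g i) (g j) = 7 →
      inner ℝ (g i) (g j) = 7 / 2 * (gramE8 i j : ℝ) := fun i j h1 h2 => by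
    rw [h1, h2]; norm_num
  have v1 : ∀ i j, gramE8 i j = 1 → inner ℝ (g i) (g j) = 7 / 2 →
      inner ℝ (g i) (g j) = 7 / 2 * (gramE8 i j : ℝ) := fun i j h1 h2 => by
    rw [h1, h2]; norm_num
  have v0 : ∀ i j, gramE8 i j = 0 → inner ℝ (g i) (g j) = 0 →
      inner ℝ (g i) (g j) = 7 / 2 * (gramE8 i j : ℝ) := fun i j h1 h2 => by
    rw [h1, h2]; norm_num
  have hle : ∀ i j, i ≤ j → inner ℝ (g i) (g j) = 7 / 2 * (gramE8 i j : ℝ) := by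
    intro i j hij
    fin_cases i <;> fin_cases j <;> try exact absurd hij (by decide)
    · exact v2 _ _ rfl (self q₀ q₁ p0 p1 n01)
    · exact v1 _ _ rfl (fst q₀ q₁ q₂ p0 p1 p2 n01 n02 n12)
    · exact v1 _ _ rfl (fst q₀ q₁ q₃ p0 p1 p3 n01 n03 n13)
    · exact v1 _ _ rfl (fst q₀ q₁ q₄ p0 p1 p4 n01 n04 n14)
    · exact v0 _ _ rfl (chain q₁ q₀ q₂ p1 p0 p2 n01 n12 n02)
    · exact v0 _ _ rfl (chain q₁ q₀ q₃ p1 p0 p3 n01 n13 n03)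
    · exact v0 _ _ rfl (chain q₁ q₀ q₄ p1 p0 p4 n01 n14 n04)
    · exact v1 _ _ rfl (hcα q₀ q₁)
    · exact v2 _ _ rfl (self q₀ q₂ p0 p2 n02)
    · exact v1 _ _ rfl (fst q₀ q₂ q₃ p0 p2 p3 n02 n03 n23)
    · exact v1 _ _ rfl (fst q₀ q₂ q₄ p0 p2 p4 n02 n04 n24)
    · exact v1 _ _ rfl (snd q₂ q₀ q₁ p2 p0 p1 n02 n12 n01)
    · exact v0 _ _ rfl (d23.1.trans (by norm_num))
    · exact v1 _ _ rfl (d24.1.trans (by norm_num))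
    · exact v1 _ _ rfl (hcα q₀ q₂)
    · exact v2 _ _ rfl (self q₀ q₃ p0 p3 n03)
    · exact v1 _ _ rfl (fst q₀ q₃ q₄ p0 p3 p4 n03 n04 n34)
    · exact v1 _ _ rfl (d23.2.trans (by norm_num))
    · exact v1 _ _ rfl (snd q₃ q₀ q₁ p3 p0 p1 n03 n13 n01)
    · exact v1 _ _ rfl (d34.1.trans (by norm_num))
    · exact v1 _ _ rfl (hcα q₀ q₃)
    · exact v2 _ _ rfl (self q₀ q₄ p0 p4 n04)
    · exact v0 _ _ rfl (d24.2.trans (by norm_num))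
    · exact v0 _ _ rfl (d34.2.trans (by norm_num))
    · exact v1 _ _ rfl (snd q₄ q₀ q₁ p4 p0 p1 n04 n14 n01)
    · exact v1 _ _ rfl (hcα q₀ q₄)
    · exact v2 _ _ rfl (self q₁ q₂ p1 p2 n12)
    · exact v1 _ _ rfl (fst q₁ q₂ q₃ p1 p2 p3 n12 n13 n23)
    · exact v1 _ _ rfl (fst q₁ q₂ q₄ p1 p2 p4 n12 n14 n24)
    · exact v1 _ _ rfl (hcα q₁ q₂)
    · exact v2 _ _ rfl (self q₁ q₃ p1 p3 n13)
    · exact v1 _ _ rfl (fst q₁ q₃ q₄ p1 p3 p4 n13 n14 n34)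
    · exact v1 _ _ rfl (hcα q₁ q₃)
    · exact v2 _ _ rfl (self q₁ q₄ p1 p4 n14)
    · exact v1 _ _ rfl (hcα q₁ q₄)
    · exact v2 _ _ rfl hα
  refine hp.false_of_unimodular g (fun i => ?_) gramE8 halfInvGramE8 (fun i j => ?_) gramE8_mul
  · have hY : ∀ j k, p ≠ j → p ≠ k → j ≠ k → (1 / 2 : ℝ) • α + cyc b p j k ∈ B :=
      fun j k h1 h2 h3 => s.mem_cycle p j k h1 h2 h3
    have hαB : α ∈ B := ((hp.mem_right _).1 s.mem).1
    fin_cases i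
    exacts [hY _ _ p0 p1 n01, hY _ _ p0 p2 n02, hY _ _ p0 p3 n03, hY _ _ p0 p4 n04,
      hY _ _ p1 p2 n12, hY _ _ p1 p3 n13, hY _ _ p1 p4 n14, hαB]
  · rcases le_total i j with hij | hij
    · exact hle i j hij
    · rw [real_inner_comm, gramE8_symm]; exact hle j i hij

/-- With all entries of the dual matrix equal to `±7`, the vanishing of its first row sum makes the
five signs belonging to the label `1` have sum `±1`. -/
theorem DesignPair.false {E : Type*} [NormedAddCommGroup E] [InnerProductSpace ℝ E]
    [FiniteDimensional ℝ E] (hE : Module.finrank ℝ E = 16) {A B : AddSubgroup E} {X Y : Finset E}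
    (h : DesignPair A B X Y 1 7) : False := by
  obtain ⟨α, x, β, hs⟩ := h.exists_star
  have s := hs.skewSystem h
  obtain ⟨T, hT, hrow, hT7⟩ := s.exists_dualMatrix h fun c =>
    hs.sq_sum_inner_orthPart_le hE (fun i => i) c
  have hr := hrow 0
  rw [Fin.sum_univ_seven] at hr
  have t1 : |T 2 3 4 5 6| = 7 := hT7 0 1 (by decide)
  have t2 : |-T 1 3 4 5 6| = 7 := hT7 0 2 (by decide)
  have t3 : |T 1 2 4 5 6| = 7 := hT7 0 3 (by decide)
  have t4 : |-T 1 2 3 5 6| = 7 := hT7 0 4 (by decide)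
  have t5 : |T 1 2 3 4 6| = 7 := hT7 0 5 (by decide)
  have t6 : |-T 1 2 3 4 5| = 7 := hT7 0 6 (by decide)
  have hr' : 0 + T 2 3 4 5 6 + -T 1 3 4 5 6 + T 1 2 4 5 6 + -T 1 2 3 5 6 + T 1 2 3 4 6 +
      -T 1 2 3 4 5 = 0 := hr
  have sign : ∀ n : ℤ, |n| = 7 → (n : ℝ) / 7 = 1 ∨ (n : ℝ) / 7 = -1 := fun n hn => by
    rcases (abs_eq (by norm_num)).1 hn with rfl | rfl <;> norm_num
  have hsum : ((-T 1 3 4 5 6 : ℤ) : ℝ) / 7 + ((T 1 2 4 5 6 : ℤ) : ℝ) / 7 +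
      ((-T 1 2 3 5 6 : ℤ) : ℝ) / 7 + ((T 1 2 3 4 6 : ℤ) : ℝ) / 7 + ((-T 1 2 3 4 5 : ℤ) : ℝ) / 7 =
      -((T 2 3 4 5 6 : ℤ) : ℝ) / 7 := by
    have hr2 : ((0 + T 2 3 4 5 6 + -T 1 3 4 5 6 + T 1 2 4 5 6 + -T 1 2 3 5 6 + T 1 2 3 4 6 +
      -T 1 2 3 4 5 : ℤ) : ℝ) = 0 := by rw [hr']; norm_num
    push_cast at hr2 ⊢
    linarith
  have hD : HasSigns (orthPart α x β) (((-T 1 3 4 5 6 : ℤ) : ℝ) / 7) (((T 1 2 4 5 6 : ℤ) : ℝ) / 7)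
      (((-T 1 2 3 5 6 : ℤ) : ℝ) / 7) (((T 1 2 3 4 6 : ℤ) : ℝ) / 7)
      (((-T 1 2 3 4 5 : ℤ) : ℝ) / 7) := by
    refine ⟨1, 2, 3, 4, 5, 6, by decide, ?_, ?_, ?_, ?_, ?_⟩ <;> rw [hT _ _ _ _ _ (by decide)] <;>
      push_cast <;> ring
  refine (hD.normalize s h (sign _ t2) (sign _ t3) (sign _ t4) (sign _ t5) (sign _ t6) ?_).false s h
  rw [hsum, neg_div]
  rcases sign _ t1 with e | e <;> rw [e] <;> norm_num

end StronglyPerfectLattice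

end

theorem mainTheorem8 :
    ¬ ∃ L : Submodule ℤ (StronglyPerfectLattice.Euc 16),
      (∃ _ : DiscreteTopology L, IsZLattice ℝ L) ∧
      StronglyPerfectLattice.IsDualStronglyPerfect L ∧
      StronglyPerfectLattice.bergeMartinet L = 7 := by
  rintro ⟨L, -, hL, hr⟩
  obtain ⟨A, B, X, Y, h⟩ := hL.exists_designPair hr
  exact h.false finrank_euclideanSpace_fin
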